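/- **Setting.** Let $d\ge 1$. A *vector-matrix-vector query* to a real symmetric $d\times d$ matrix $A$ consists of a pair $v,w\in\mathbb R^d$ and returns $v^TAw$; a randomized adaptive algorithm may choose each query depending on its random coins and on the answers received so far. For $p\in[1,\infty]$, $\|A\|_p$ is the Schatten $p$-norm, i.e. the $\ell_p$ norm of the vector of the $d$ singular values of $A$. For $0<\epsilon<1$, an *$(\epsilon,\ell_p)$-tester* is such an algorithm which, on every symmetric $A$, outputs True with probability at least $2/3$ if $A$ is positive semidefinite (PSD), and outputs False with probability at least $2/3$ if $A\ne 0$ and $\lambda_{\min}(A)\le-\epsilon\|A\|_p$. It is *one-sided* if it outputs True on every PSD input for every outcome of its random coins. It is *of Oja type* if it has the following form, for some $k,R,N\in\mathbb N$ and measurable functions $\eta_1,\dots,\eta_R:\mathbb R^k\to(0,\infty)$. All random vectors are independent with law $\mathcal N(0,I_d)$. It first makes $k$ queries $(v_i,w_i)$ with random $v_i,w_i$ and receives $s\in\mathbb R^k$. Then, for $r=1,\dots,R$, it starts from a random $x$ and performs $N$ steps $$x\leftarrow (I-\eta\, g g^T A)\,x = x-\eta\,(g^TAx)\,g,\qquad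 \eta=\eta_r(s),$$ with a fresh random $g$ in each step. It stops and outputs False as soon as some iterate (the initial and final ones included) has $x^TAx<0$, and outputs True if this never happens. **Theorem.** For all $d\ge1$, $p\in[1,\infty]$ and real $d\times d$ matrices $A$, $$\|A\|_p\ \ge\ d^{1/p-1}\|A\|_1 .$$ Moreover, there is an absolute constant $C>0$ such that the following hold. 1. For all $d\ge 1$ and $0<\epsilon<1$ there is a one-sided adaptive $(\epsilon,\ell_1)$-tester of Oja type for $d\times d$ matrices that always makes at most $C\,\frac1\epsilon\log^3\frac2\epsilon$ vector-matrix-vector queries; in particular it makes $O(\frac1\epsilon\log^3\frac1\epsilon)$ queries for $\epsilon\le\frac12$, independently of $d$. 2. For all $d\ge 1$, $p\in[1,\infty]$ and $0<\epsilon<1$ there is a one-sided adaptive $(\epsilon,\ell_p)$-tester of Oja type for $d\times d$ matrices that always makes at most $C\,\frac1\epsilon d^{1-1/p}\log^3\!\big(\frac2\epsilon d^{1-1/p}\big)=\widetilde O(d^{1-1/p}/\epsilon)$ vector-matrix-vector queries. -/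

import Mathlib

open MeasureTheory ProbabilityTheory
open scoped ENNReal

noncomputable section

namespace PSDTesting

/-! ### Schatten norms and distance from the PSD cone -/

/-- The Schatten `p`-norm of a real `d × d` matrix, `1 ≤ p ≤ ∞`: the `ℓ_p` norm of its vector of
singular values. -/
def schattenNorm {d : ℕ} (p : ℝ≥0∞) (A : Matrix (Fin d) (Fin d) ℝ) : ℝ :=
  ‖(WithLp.toLp p (fun i : Fin d => A.toEuclideanLin.singularValues i) : PiLp p fun _ : Fin d => ℝ)‖

/-- The least eigenvalue of a real symmetric matrix (of size `d ≥ 1`). -/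
def minEigenvalue {d : ℕ} {A : Matrix (Fin d) (Fin d) ℝ} (hA : A.IsHermitian) : ℝ :=
  ⨅ i : Fin d, hA.eigenvalues i

/-- `A` is a nonzero symmetric matrix with `λ_min(A) ≤ -ε ‖A‖_p`. The zero matrix satisfies the
inequality but is PSD, so it has to be excluded. -/
def IsFarFromPSD {d : ℕ} (ε : ℝ) (p : ℝ≥0∞) (A : Matrix (Fin d) (Fin d) ℝ) : Prop :=
  A ≠ 0 ∧ ∃ hA : A.IsHermitian, minEigenvalue hA ≤ -(ε * schattenNorm p A)

/-! ### Adaptive algorithms in the vector-matrix-vector query model -/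

/-- A deterministic adaptive algorithm: it either stops with an answer, or queries the pair `(v, w)`
and continues depending on the value `vᵀ A w` it receives. -/
inductive VMVAlgorithm (d : ℕ) : Type
  | answer (b : Bool) : VMVAlgorithm d
  | query (v w : Fin d → ℝ) (next : ℝ → VMVAlgorithm d) : VMVAlgorithm d

namespace VMVAlgorithm

/-- The answer on input `A`. -/
def output {d : ℕ} (A : Matrix (Fin d) (Fin d) ℝ) : VMVAlgorithm d → Bool
  | answer b => b
  | query v w next => output A (next (v ⬝ᵥ A.mulVec w))

/-- The number of queries made on input `A`. -/
def numQueries {d : ℕ} (A : Matrix (Fin d) (Fin d) ℝ) : VMVAlgorithm d → ℕ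
  | answer _ => 0
  | query v w next => numQueries A (next (v ⬝ᵥ A.mulVec w)) + 1

end VMVAlgorithm

/-- A randomized adaptive algorithm: the random coins `ω ∈ Ω` select a deterministic one. -/
structure VMVTester (d : ℕ) where
  Ω : Type
  [measurableSpace : MeasurableSpace Ω]
  μ : Measure Ω
  [isProbabilityMeasure : IsProbabilityMeasure μ]
  alg : Ω → VMVAlgorithm d

attribute [instance] VMVTester.measurableSpace VMVTester.isProbabilityMeasure

namespace VMVTester

/-- The set of random coins for which the answer on input `A` is `b`. -/
def outcome {d : ℕ} (T : VMVTester d) (A : Matrix (Fin d) (Fin d) ℝ) (b : Bool) : Set T.Ω :=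
  {ω | (T.alg ω).output A = b}

/-- `T` is an `(ε, ℓ_p)`-tester: the answer is a random variable on every symmetric input, it is
`true` with probability at least `2/3` on PSD inputs and `false` with probability at least `2/3` on
inputs that are `ε`-far from the PSD cone. -/
structure IsTester {d : ℕ} (T : VMVTester d) (ε : ℝ) (p : ℝ≥0∞) : Prop where
  measurableSet_outcome : ∀ A : Matrix (Fin d) (Fin d) ℝ, A.IsSymm → ∀ b,
    MeasurableSet (T.outcome A b)
  accepts : ∀ A : Matrix (Fin d) (Fin d) ℝ, A.PosSemidef → 2 / 3 ≤ T.μ.real (T.outcome A true)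
  rejects : ∀ A : Matrix (Fin d) (Fin d) ℝ, IsFarFromPSD ε p A →
    2 / 3 ≤ T.μ.real (T.outcome A false)

/-- One-sided error: every PSD input is accepted, whatever the random coins are. -/
def IsOneSided {d : ℕ} (T : VMVTester d) : Prop :=
  ∀ A : Matrix (Fin d) (Fin d) ℝ, A.PosSemidef → ∀ ω, (T.alg ω).output A = true

/-- `T` makes at most `B` queries, for all random coins and all symmetric inputs. -/
def MakesAtMost {d : ℕ} (T : VMVTester d) (B : ℝ) : Prop :=
  ∀ A : Matrix (Fin d) (Fin d) ℝ, A.IsSymm → ∀ ω, ((T.alg ω).numQueries A : ℝ) ≤ B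

end VMVTester

/-! ### Testers based on the Oja-type iteration -/

/-- The standard Gaussian distribution `N(0, I_d)`. -/
def gaussianVector (d : ℕ) : Measure (Fin d → ℝ) :=
  Measure.pi fun _ => gaussianReal 0 1

instance (d : ℕ) : IsProbabilityMeasure (gaussianVector d) := by
  unfold gaussianVector; infer_instance

/-- Starting at `x`, perform `N` steps `x ← x - η (gᵀ A x) g = (I - η g gᵀ A) x`, where `g` runs
through `g 0, …, g (N - 1)`. As soon as an iterate (the starting point and the last one included)
has `xᵀ A x < 0`, answer `false`. If this never happens, continue with `rest`. -/
def ojaRun {d : ℕ} (η : ℝ) (rest : VMVAlgorithm d) :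
    (N : ℕ) → (Fin N → Fin d → ℝ) → (Fin d → ℝ) → VMVAlgorithm d
  | 0, _, x => .query x x fun q => if q < 0 then .answer false else rest
  | N + 1, g, x => .query x x fun q => if q < 0 then .answer false else
      .query (g 0) x fun s => ojaRun η rest N (Fin.tail g) (x - (η * s) • g 0)

/-- `R` runs of the iteration in succession, the `r`-th one with step size `η r`, starting point
`x r` and directions `g r 0, …, g r (N - 1)`. Answer `true` if no run answers `false`. -/
def ojaRuns {d N : ℕ} : (R : ℕ) → (Fin R → ℝ) → (Fin R → Fin d → ℝ) →
    (Fin R → Fin N → Fin d → ℝ) → VMVAlgorithm d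
  | 0, _, _, _ => .answer true
  | R + 1, η, x, g =>
      ojaRun (η 0) (ojaRuns R (Fin.tail η) (Fin.tail x) (Fin.tail g)) N (g 0) (x 0)

/-- Query the pairs `(v i, w i)`, `i < k`, and continue depending on the `k` values received. -/
def probe {d : ℕ} : (k : ℕ) → (Fin k → Fin d → ℝ) → (Fin k → Fin d → ℝ) →
    ((Fin k → ℝ) → VMVAlgorithm d) → VMVAlgorithm d
  | 0, _, _, next => next Fin.elim0
  | k + 1, v, w, next => .query (v 0) (w 0) fun s =>
      probe k (Fin.tail v) (Fin.tail w) fun t => next (Fin.cons s t)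

/-- The Oja-type tester. All vectors below are independent standard Gaussian vectors in `ℝ^d`.
First query `k` pairs of such vectors. The values received determine the step sizes of `R` runs of
at most `N` steps each of the Oja-type iteration, with Gaussian starting points and directions.
Answer `false` as soon as some iterate has `xᵀ A x < 0`, and `true` if this never happens. -/
def ojaTester (d k R N : ℕ) (step : (Fin k → ℝ) → Fin R → ℝ) : VMVTester d where
  Ω := (Fin k → Fin d → ℝ) × (Fin k → Fin d → ℝ) ×
    (Fin R → Fin d → ℝ) × (Fin R → Fin N → Fin d → ℝ)
  μ := (Measure.pi fun _ => gaussianVector d).prod <|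
    (Measure.pi fun _ => gaussianVector d).prod <|
    (Measure.pi fun _ => gaussianVector d).prod <|
    Measure.pi fun _ => Measure.pi fun _ => gaussianVector d
  alg := fun ω => probe k ω.1 ω.2.1 fun s => ojaRuns R (step s) ω.2.2.1 ω.2.2.2

/-- `T` is an Oja-type tester, with positive step sizes that are measurable functions of the values
of the preliminary queries. -/
def VMVTester.IsOjaType {d : ℕ} (T : VMVTester d) : Prop :=
  ∃ (k R N : ℕ) (step : (Fin k → ℝ) → Fin R → ℝ),
    Measurable step ∧ (∀ s r, 0 < step s r) ∧ T = ojaTester d k R N step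

end PSDTesting

end

/-! Everything is reduced to one matrix `A` with eigenvalues `l i`, `∑ |l i| ≤ S` and least
eigenvalue `-μ ≤ -ε S`. One-sidedness is automatic, since a PSD form is never negative at an
iterate. The `ℓ_p` case is the `ℓ_1` case with `ε` scaled by `d ^ (1/p - 1)`, by the power mean
inequality.

Rejection is a second-moment argument. In the eigenbasis the conditional mean of the `i`-th
coordinate after `n` steps is `(1 - η l i) ^ n` times its initial value, so negative directions grow
and their noiseless contribution to the form is `negGrowth`, called `W` here. The noise injected at
each step is governed by `energy`, the second moment of `A x`. The expected value of the quadratic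
form serves as a potential: for `η S ≤ 1/3` each step lowers it by at least `η * energy`
(`sum_energy_le`), so the accumulated energy is at most `S` plus the expected negative part. The
negative part in turn is at most `W` plus amplified noise (`neg_part_le`), and a strong induction
closes this circle (`sum_energy_le_negGrowth`). If `η S` and `(n η μ)(η S)` are both small and `S`
is small relative to `W`, then positive part and noise together are a small fraction of `W`
(`sum_abs_mul_secondMoment_le`).

To turn moments into probability, note that if the form is still nonnegative at the `n`-th iterate,
then either its positive part or the deviation of the negative coordinates from their conditional
means is comparable to the noiseless contribution (`half_sum_le_of_form_nonneg`). Gaussian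
anti-concentration makes the latter at least of order `W` for most starting points, and Markov's
inequality bounds the former (`lintegral_measure_runAccepts_le`). No bound depends on `d`, as only
`S`, `μ` and `W` enter.

The growth needs `n` of order `log(1/ε)/(η μ)`, and the noise then forces `η S` to be of order
`1/log(1/ε)`. This gives runs of length `O(log²(1/ε)/ε)`. Since `S` is unknown, one Gaussian
bilinear query estimates it up to a factor of order `1/ε`, and `O(log(1/ε))` dyadic step sizes are
tried. Runs with a wrong step size do no harm because the error is one-sided. -/

namespace PSDTesting

/-! ### Second-moment recursion in the eigenbasis -/

section Moments

variable {ι : Type*} [Fintype ι]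

/-- The second moments of the coordinates, in an eigenbasis with eigenvalues `l`, of the iterates of
the Oja-type iteration with step size `η`, started at a standard Gaussian vector. -/
def secondMoment (l : ι → ℝ) (η : ℝ) : ℕ → ι → ℝ
  | 0, _ => 1
  | k + 1, i => (1 - 2 * η * l i + 2 * η ^ 2 * l i ^ 2) * secondMoment l η k i +
      η ^ 2 * ∑ j, l j ^ 2 * secondMoment l η k j

/-- The second moment of `A x` at the `k`-th iterate `x`. -/
def energy (l : ι → ℝ) (η : ℝ) (k : ℕ) : ℝ := ∑ j, l j ^ 2 * secondMoment l η k j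

/-- The weighted growth of the negative directions in the absence of noise. -/
def negGrowth (l : ι → ℝ) (η : ℝ) (k : ℕ) : ℝ :=
  ∑ i, max (-l i) 0 * ((1 + η * max (-l i) 0) ^ 2) ^ k

lemma secondMoment_succ (l : ι → ℝ) (η : ℝ) (k : ℕ) (i : ι) :
    secondMoment l η (k + 1) i = (1 - 2 * η * l i + 2 * η ^ 2 * l i ^ 2) * secondMoment l η k i +
      η ^ 2 * energy l η k := rfl

lemma secondMoment_nonneg (l : ι → ℝ) (η : ℝ) (k : ℕ) (i : ι) : 0 ≤ secondMoment l η k i := by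
  induction k generalizing i with
  | zero => simp [secondMoment]
  | succ k ih =>
    rw [secondMoment_succ, energy]
    have h1 : 0 ≤ 1 - 2 * η * l i + 2 * η ^ 2 * l i ^ 2 := by
      nlinarith [sq_nonneg (1 - η * l i), sq_nonneg (η * l i)]
    have h2 : 0 ≤ ∑ j, l j ^ 2 * secondMoment l η k j :=
      Finset.sum_nonneg fun j _ => mul_nonneg (sq_nonneg _) (ih j)
    have := ih i
    positivity

lemma energy_nonneg (l : ι → ℝ) (η : ℝ) (k : ℕ) : 0 ≤ energy l η k :=
  Finset.sum_nonneg fun j _ => mul_nonneg (sq_nonneg _) (secondMoment_nonneg l η k j)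

lemma sq_mul_secondMoment_le_energy (l : ι → ℝ) (η : ℝ) (k : ℕ) (i : ι) :
    l i ^ 2 * secondMoment l η k i ≤ energy l η k :=
  Finset.single_le_sum (f := fun j => l j ^ 2 * secondMoment l η k j)
    (fun j _ => mul_nonneg (sq_nonneg _) (secondMoment_nonneg l η k j)) (Finset.mem_univ i)

lemma negGrowth_nonneg (l : ι → ℝ) (η : ℝ) (k : ℕ) : 0 ≤ negGrowth l η k :=
  Finset.sum_nonneg fun _ _ => by positivity

/-- The solution of the recursion `b (k + 1) = s * b k + u k`, `b 0 = 0`. -/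
def forced (s : ℝ) (u : ℕ → ℝ) : ℕ → ℝ
  | 0 => 0
  | k + 1 => s * forced s u k + u k

/-- For `l i < 0` the factor in the recursion is `(1 + η |l i|) ^ 2 + η ^ 2 * l i ^ 2`. The excess
`η ^ 2 * l i ^ 2 * secondMoment` is at most `η ^ 2 * energy`, which doubles the forcing term. -/
lemma neg_secondMoment_le (l : ι → ℝ) {η : ℝ} (k : ℕ) (i : ι) :
    max (-l i) 0 * secondMoment l η k i ≤ max (-l i) 0 * (((1 + η * max (-l i) 0) ^ 2) ^ k +
      2 * η * forced ((1 + η * max (-l i) 0) ^ 2) (fun j => η * energy l η j) k) := by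
  rcases le_or_gt 0 (l i) with h | h
  · simp [max_eq_right (neg_nonpos.2 h)]
  rw [max_eq_left (by linarith)]
  refine mul_le_mul_of_nonneg_left ?_ (by linarith)
  induction k with
  | zero => simp [secondMoment, forced]
  | succ k ih =>
    rw [secondMoment_succ, forced, pow_succ (_ ^ 2) k]
    have h1 := mul_le_mul_of_nonneg_left ih (sq_nonneg (1 + η * -l i))
    have h2 := mul_le_mul_of_nonneg_left (sq_mul_secondMoment_le_energy l η k i) (sq_nonneg η)
    linarith

/-- For `0 < l i` and `η * l i ≤ 1` the factor in the recursion is at most one, so only the injected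
noise accumulates. -/
lemma pos_secondMoment_le (l : ι → ℝ) {η : ℝ} (i : ι) (hη : 0 ≤ η) (hl : η * l i ≤ 1) (k : ℕ) :
    max (l i) 0 * secondMoment l η k i ≤
      max (l i) 0 * (1 + η * ∑ j ∈ Finset.range k, η * energy l η j) := by
  rcases le_or_gt (l i) 0 with h | h
  · simp [max_eq_right h]
  rw [max_eq_left h.le]
  refine mul_le_mul_of_nonneg_left ?_ h.le
  induction k with
  | zero => simp [secondMoment]
  | succ k ih =>
    rw [secondMoment_succ, Finset.sum_range_succ]
    have h1 : (1 - 2 * η * l i + 2 * η ^ 2 * l i ^ 2) * secondMoment l η k i ≤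
        secondMoment l η k i := by
      refine mul_le_of_le_one_left (secondMoment_nonneg l η k i) ?_
      nlinarith [mul_nonneg hη h.le]
    linarith

/-- The expected quadratic form is a potential. One step changes it by at most `(-2 η + 3 η ^ 2 S) *
energy ≤ -η * energy`, and its initial value is the trace. -/
lemma sum_energy_le (l : ι → ℝ) {η S : ℝ} (hη : 0 ≤ η) (hS : ∑ i, |l i| ≤ S) (hηS : 3 * (η * S) ≤ 1)
    (k : ℕ) : ∑ j ∈ Finset.range k, η * energy l η j + ∑ i, l i * secondMoment l η k i ≤ S := by
  have hle : ∀ i, l i ≤ S := fun i => (le_abs_self _).trans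
    ((Finset.single_le_sum (f := fun j => |l j|) (fun j _ => abs_nonneg _)
      (Finset.mem_univ i)).trans hS)
  have htr : ∑ i, l i ≤ S := (Finset.sum_le_sum fun i _ => le_abs_self _).trans hS
  induction k with
  | zero => simpa [secondMoment] using htr
  | succ k ih =>
    have key : ∑ i, l i * secondMoment l η (k + 1) i = ∑ i, l i * secondMoment l η k i
        - 2 * η * energy l η k + 2 * η ^ 2 * ∑ i, l i * (l i ^ 2 * secondMoment l η k i)
        + η ^ 2 * energy l η k * ∑ i, l i := by
      rw [energy, Finset.mul_sum, Finset.mul_sum, Finset.mul_sum _ (fun i => l i), ← energy,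
        ← Finset.sum_sub_distrib, ← Finset.sum_add_distrib, ← Finset.sum_add_distrib]
      refine Finset.sum_congr rfl fun i _ => ?_
      rw [secondMoment_succ]; ring
    have h1 : ∑ i, l i * (l i ^ 2 * secondMoment l η k i) ≤ S * energy l η k := by
      rw [energy, Finset.mul_sum]
      exact Finset.sum_le_sum fun i _ => mul_le_mul_of_nonneg_right (hle i)
        (mul_nonneg (sq_nonneg _) (secondMoment_nonneg l η k i))
    have hq := energy_nonneg l η k
    have h2 := mul_le_mul_of_nonneg_left h1 (sq_nonneg η)
    have h3 := mul_le_mul_of_nonneg_left htr (mul_nonneg (sq_nonneg η) hq)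
    have h4 := mul_le_mul_of_nonneg_right hηS (mul_nonneg hη hq)
    rw [Finset.sum_range_succ, key]
    nlinarith

/-- Summation by parts: with `U j` the partial sums of `u`, the solution is `U k + (s - 1) ∑_{j<k} s
^ (k-1-j) U j`. Inserting the bound on `U j`, the constant part sums to a geometric series, and each
mixed product of powers is at most `max (s i) (s l) ^ k`. -/
lemma forced_le {s : ι → ℝ} {u : ℕ → ℝ} {w : ι → ℝ} {S : ℝ} (hs : ∀ i, 1 ≤ s i) (hw : ∀ i, 0 ≤ w i)
    (k : ℕ) (hU : ∀ j < k, ∑ a ∈ Finset.range j, u a ≤ 2 * S + 2 * ∑ l, w l * s l ^ j) (i : ι) :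
    forced (s i) u k ≤ ∑ j ∈ Finset.range k, u j + 2 * S * (s i ^ k - 1) +
      2 * ∑ l, w l * ((s i - 1) * k * max (s i) (s l) ^ k) := by
  induction k with
  | zero => simp [forced]
  | succ k ih =>
    have ih := ih fun j hj => hU j (by omega)
    have hk := hU k (by omega)
    have hsi := hs i
    have key : s i * ∑ l, w l * ((s i - 1) * k * max (s i) (s l) ^ k) +
        (s i - 1) * ∑ l, w l * s l ^ k ≤
        ∑ l, w l * ((s i - 1) * ((k + 1 : ℕ) : ℝ) * max (s i) (s l) ^ (k + 1)) := by
      rw [Finset.mul_sum, Finset.mul_sum, ← Finset.sum_add_distrib]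
      refine Finset.sum_le_sum fun l _ => ?_
      have hm : 1 ≤ max (s i) (s l) := hsi.trans (le_max_left _ _)
      have h1 : s i * max (s i) (s l) ^ k ≤ max (s i) (s l) ^ (k + 1) := by
        rw [pow_succ']
        exact mul_le_mul_of_nonneg_right (le_max_left _ _) (by positivity)
      have h2 : s l ^ k ≤ max (s i) (s l) ^ (k + 1) :=
        (pow_le_pow_left₀ (by linarith [hs l]) (le_max_right _ _) k).trans
          (pow_le_pow_right₀ hm (by omega))
      have h0 : 0 ≤ w l * (s i - 1) := mul_nonneg (hw l) (by linarith)
      have h3 := mul_le_mul_of_nonneg_left h1 (mul_nonneg h0 (Nat.cast_nonneg (α := ℝ) k))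
      have h4 := mul_le_mul_of_nonneg_left h2 h0
      push_cast
      linarith
    rw [forced, Finset.sum_range_succ, pow_succ]
    have h5 := mul_le_mul_of_nonneg_left ih (by linarith : 0 ≤ s i)
    have h6 := mul_le_mul_of_nonneg_left hk (by linarith : 0 ≤ s i - 1)
    linarith

/-- The double sum from `forced_le` decouples by `max a b ^ k ≤ a ^ k + b ^ k`, leaving a bound
linear in the weighted growth. -/
lemma sum_mul_forced_le {s : ι → ℝ} {u : ℕ → ℝ} {w : ι → ℝ} {S t U : ℝ} (hs : ∀ i, 1 ≤ s i)
    (hw : ∀ i, 0 ≤ w i) (hwS : ∑ i, w i ≤ S) (ht : ∀ i, s i - 1 ≤ t) (ht0 : 0 ≤ t)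
    (k : ℕ) (hu : ∀ j, 0 ≤ u j)
    (hU : ∀ j < k, ∑ a ∈ Finset.range j, u a ≤ 2 * S + 2 * ∑ l, w l * s l ^ j)
    (hUk : ∑ j ∈ Finset.range k, u j = U) :
    ∑ i, w i * forced (s i) u k ≤
      S * U + 2 * S * ∑ i, w i * s i ^ k + 4 * (k * t) * S * ∑ i, w i * s i ^ k := by
  have hU0 : 0 ≤ U := hUk ▸ Finset.sum_nonneg fun j _ => hu j
  have hS : 0 ≤ S := (Finset.sum_nonneg fun i _ => hw i).trans hwS
  set W := ∑ i, w i * s i ^ k with hWdef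
  have hW0 : 0 ≤ W := Finset.sum_nonneg fun i _ => mul_nonneg (hw i)
    (pow_nonneg (by linarith [hs i]) _)
  have h1 : ∀ i, w i * forced (s i) u k ≤ w i * U + 2 * S * (w i * s i ^ k) +
      2 * (k * t) * (w i * s i ^ k * S + w i * W) := by
    intro i
    have hf := forced_le hs hw k hU i
    rw [hUk] at hf
    have h2 : ∑ l, w l * ((s i - 1) * k * max (s i) (s l) ^ k) ≤
        k * t * (s i ^ k * S + W) := by
      calc _ ≤ ∑ l, k * t * (w l * s i ^ k + w l * s l ^ k) := by
            refine Finset.sum_le_sum fun l _ => ?_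
            have hmax : max (s i) (s l) ^ k ≤ s i ^ k + s l ^ k := by
              have := pow_nonneg (by linarith [hs i] : 0 ≤ s i) k
              have := pow_nonneg (by linarith [hs l] : 0 ≤ s l) k
              rcases max_choice (s i) (s l) with h | h <;> rw [h] <;> linarith
            have hm0 : 0 ≤ max (s i) (s l) ^ k :=
              pow_nonneg (le_max_of_le_left (by linarith [hs i])) _
            have h3 : (s i - 1) * k * max (s i) (s l) ^ k ≤ t * k * (s i ^ k + s l ^ k) :=
              mul_le_mul (mul_le_mul_of_nonneg_right (ht i) (Nat.cast_nonneg k)) hmax hm0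
                (by positivity)
            have := mul_le_mul_of_nonneg_left h3 (hw l)
            linarith
        _ = k * t * (s i ^ k * ∑ l, w l + W) := by
            rw [← Finset.mul_sum, Finset.sum_add_distrib, ← Finset.sum_mul, ← hWdef]; ring
        _ ≤ _ := by
            have := pow_nonneg (by linarith [hs i] : 0 ≤ s i) k
            gcongr
    have h4 := mul_le_mul_of_nonneg_left hf (hw i)
    have h5 := mul_le_mul_of_nonneg_left h2 (hw i)
    have h6 := mul_nonneg hS (hw i)
    linarith
  have h7 := Finset.sum_le_sum fun i (_ : i ∈ Finset.univ) => h1 i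
  rw [Finset.sum_add_distrib, Finset.sum_add_distrib, ← Finset.sum_mul, ← Finset.mul_sum,
    ← Finset.mul_sum, Finset.sum_add_distrib, ← Finset.sum_mul, ← Finset.sum_mul, ← hWdef] at h7
  have h8 := mul_le_mul_of_nonneg_right hwS hU0
  have h9 := mul_le_mul_of_nonneg_right hwS hW0
  have h10 := mul_le_mul_of_nonneg_left h9 (by positivity : 0 ≤ (k : ℝ) * t)
  linarith

/-- The energy bound is required only at times before `k`, so that this can serve as the induction
step for that bound. The noise is `2 η` times the bound of `sum_mul_forced_le` with `t = 3 η μ`; its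
growth terms contribute `4 κ + 24 κ`. -/
lemma neg_part_le (l : ι → ℝ) {η S μ κ : ℝ} (hη : 0 ≤ η) (hS : ∑ i, |l i| ≤ S) (hμ : ∀ i, -l i ≤ μ)
    (hμ0 : 0 ≤ μ) (hμS : μ ≤ S) (hκ : κ ≤ 1 / 100) (hηS : η * S ≤ κ) (k : ℕ)
    (hk : k * (η * μ) * (η * S) ≤ κ)
    (hU : ∀ j < k, ∑ a ∈ Finset.range j, η * energy l η a ≤ 2 * S + 2 * negGrowth l η j) :
    ∑ i, max (-l i) 0 * secondMoment l η k i ≤ negGrowth l η k +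
      2 * κ * ∑ j ∈ Finset.range k, η * energy l η j + 28 * κ * negGrowth l η k := by
  have hημ : η * μ ≤ 1 := (mul_le_mul_of_nonneg_left hμS hη).trans (by linarith)
  have hmono : ∀ i, max (-l i) 0 ≤ μ := fun i => max_le (hμ i) hμ0
  have hsum : ∑ i, max (-l i) 0 ≤ S := (Finset.sum_le_sum fun i _ =>
    max_le (neg_le_abs _) (abs_nonneg _)).trans hS
  have h1 : ∑ i, max (-l i) 0 * secondMoment l η k i ≤ negGrowth l η k + 2 * η *
      ∑ i, max (-l i) 0 * forced ((1 + η * max (-l i) 0) ^ 2) (fun j => η * energy l η j) k := by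
    rw [negGrowth, Finset.mul_sum, ← Finset.sum_add_distrib]
    refine Finset.sum_le_sum fun i _ => (neg_secondMoment_le l k i).trans (le_of_eq (by ring))
  have h2 := sum_mul_forced_le (s := fun i => (1 + η * max (-l i) 0) ^ 2)
    (u := fun j => η * energy l η j) (w := fun i => max (-l i) 0) (S := S) (t := 3 * (η * μ))
    (fun i => one_le_pow₀ (by
      have : 0 ≤ η * max (-l i) 0 := by positivity
      linarith))
    (fun i => le_max_right _ _) hsum
    (fun i => by
      have h3 := mul_le_mul_of_nonneg_left (hmono i) hη
      have h4 : 0 ≤ η * max (-l i) 0 := by positivity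
      nlinarith) (by positivity) k
    (fun j => mul_nonneg hη (energy_nonneg l η j)) hU rfl
  have hU0 : 0 ≤ ∑ j ∈ Finset.range k, η * energy l η j :=
    Finset.sum_nonneg fun j _ => mul_nonneg hη (energy_nonneg l η j)
  have hW0 := negGrowth_nonneg l η k
  have h5 := mul_le_mul_of_nonneg_left h2 hη
  have h6 := mul_le_mul_of_nonneg_right hηS hU0
  have h7 := mul_le_mul_of_nonneg_right hηS hW0
  have h8 := mul_le_mul_of_nonneg_right hk hW0
  simp only [negGrowth] at *
  linarith

/-- With `U` the accumulated energy, the potential bound gives `U ≤ S +` negative part, and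
`neg_part_le` bounds the negative part by `(1 + 28 κ) * negGrowth + 2 κ U`. For `κ ≤ 1/100` the `U`
on the right is absorbed. -/
lemma sum_energy_le_negGrowth (l : ι → ℝ) {η S μ κ : ℝ} (hη : 0 ≤ η) (hS : ∑ i, |l i| ≤ S)
    (hμ : ∀ i, -l i ≤ μ) (hμ0 : 0 ≤ μ) (hμS : μ ≤ S) (hκ : κ ≤ 1 / 100) (hηS : η * S ≤ κ) {n : ℕ}
    (hn : n * (η * μ) * (η * S) ≤ κ) (k : ℕ) (hk : k ≤ n) :
    ∑ j ∈ Finset.range k, η * energy l η j ≤ 2 * S + 2 * negGrowth l η k := by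
  have hS0 : 0 ≤ S := hμ0.trans hμS
  induction k using Nat.strong_induction_on with
  | _ k ih =>
    have h1 := neg_part_le l hη hS hμ hμ0 hμS hκ hηS k (by
      refine le_trans ?_ hn
      have : (k : ℝ) ≤ n := by exact_mod_cast hk
      gcongr) fun j hj => ih j hj (by omega)
    have h2 := sum_energy_le l hη hS (by linarith) k
    have h3 : -∑ i, max (-l i) 0 * secondMoment l η k i ≤ ∑ i, l i * secondMoment l η k i := by
      rw [← Finset.sum_neg_distrib]
      refine Finset.sum_le_sum fun i _ => ?_
      rw [← neg_mul]
      refine mul_le_mul_of_nonneg_right ?_ (secondMoment_nonneg l η k i)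
      linarith [le_max_left (-l i) 0]
    have hU0 : 0 ≤ ∑ j ∈ Finset.range k, η * energy l η j :=
      Finset.sum_nonneg fun j _ => mul_nonneg hη (energy_nonneg l η j)
    have hW0 := negGrowth_nonneg l η k
    have h4 := mul_le_mul_of_nonneg_right hκ hU0
    have h5 := mul_le_mul_of_nonneg_right hκ hW0
    linarith

/-- After `n` steps the positive part of the quadratic form and the noise in the negative part are
small compared with the noiseless growth of the negative part. -/
lemma sum_abs_mul_secondMoment_le (l : ι → ℝ) {η S μ κ : ℝ} (hη : 0 ≤ η) (hS : ∑ i, |l i| ≤ S)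
    (hμ : ∀ i, -l i ≤ μ) (hμ0 : 0 ≤ μ) (hμS : μ ≤ S) (hκ0 : 0 ≤ κ) (hκ : κ ≤ 1 / 100)
    (hηS : η * S ≤ κ) {n : ℕ} (hn : n * (η * μ) * (η * S) ≤ κ) (hgrow : S ≤ κ * negGrowth l η n) :
    ∑ i, |l i| * secondMoment l η n i ≤ (1 + 41 * κ) * negGrowth l η n := by
  have hS0 : 0 ≤ S := hμ0.trans hμS
  have hU := sum_energy_le_negGrowth l hη hS hμ hμ0 hμS hκ hηS hn
  have h1 := neg_part_le l hη hS hμ hμ0 hμS hκ hηS n hn fun j hj => hU j hj.le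
  have hUn := hU n le_rfl
  have hU0 : 0 ≤ ∑ j ∈ Finset.range n, η * energy l η j :=
    Finset.sum_nonneg fun j _ => mul_nonneg hη (energy_nonneg l η j)
  have h2 : ∑ i, max (l i) 0 * secondMoment l η n i ≤
      S * (1 + η * ∑ j ∈ Finset.range n, η * energy l η j) := by
    calc _ ≤ ∑ i, max (l i) 0 * (1 + η * ∑ j ∈ Finset.range n, η * energy l η j) :=
          Finset.sum_le_sum fun i _ => pos_secondMoment_le l i hη (by
            have : l i ≤ S := (le_abs_self _).trans
              ((Finset.single_le_sum (f := fun j => |l j|) (fun j _ => abs_nonneg _)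
                (Finset.mem_univ i)).trans hS)
            have := mul_le_mul_of_nonneg_left this hη
            linarith) n
      _ ≤ _ := by
          rw [← Finset.sum_mul]
          refine mul_le_mul_of_nonneg_right ?_ (by positivity)
          exact (Finset.sum_le_sum fun i _ => max_le (le_abs_self _) (abs_nonneg _)).trans hS
  have h3 : ∑ i, |l i| * secondMoment l η n i = ∑ i, max (l i) 0 * secondMoment l η n i +
      ∑ i, max (-l i) 0 * secondMoment l η n i := by
    rw [← Finset.sum_add_distrib]
    refine Finset.sum_congr rfl fun i _ => ?_
    rw [← add_mul]
    congr 1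
    rcases le_total 0 (l i) with h | h
    · rw [abs_of_nonneg h, max_eq_left h, max_eq_right (by linarith), add_zero]
    · rw [abs_of_nonpos h, max_eq_right h, max_eq_left (by linarith), zero_add]
  have hW0 := negGrowth_nonneg l η n
  have h4 := mul_le_mul_of_nonneg_right hηS hU0
  have h5 := mul_le_mul_of_nonneg_left hUn hκ0
  have h6 := mul_le_mul_of_nonneg_left hgrow hκ0
  have h7 := mul_le_mul_of_nonneg_right hκ (mul_nonneg hκ0 hW0)
  rw [h3]
  nlinarith

end Moments

/-! ### Moments and anti-concentration of Gaussian vectors -/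

section Gaussian

lemma integral_pow_four_gaussianReal (v : NNReal) : ∫ x, x ^ 4 ∂gaussianReal 0 v = 3 * (v : ℝ) ^ 2 := by
  have h := iteratedDeriv_mgf_zero (X := id) (μ := gaussianReal 0 v)
    (by rw [integrableExpSet_id_gaussianReal]; simp) 4
  rw [mgf_id_gaussianReal] at h
  have h2 : ∫ x, x ^ 4 ∂gaussianReal 0 v = (gaussianReal 0 v)[id ^ 4] := rfl
  rw [h2, ← h]
  -- Each derivative of the moment generating function is a polynomial times the same exponential,
  -- so four applications of this rule give the fourth moment.
  have hd : ∀ p q : ℝ → ℝ, (∀ t, HasDerivAt p (q t) t) →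
      deriv (fun t => p t * Real.exp (v * t ^ 2 / 2)) =
        fun t => (q t + v * t * p t) * Real.exp (v * t ^ 2 / 2) := by
    intro p q hp
    ext t
    have h1 : HasDerivAt (fun t : ℝ => (v : ℝ) * t ^ 2 / 2) (v * t) t :=
      (((hasDerivAt_pow 2 t).const_mul (v : ℝ)).div_const 2).congr_deriv (by norm_num; ring)
    have := (hp t).fun_mul h1.exp
    rw [this.deriv]
    ring
  rw [iteratedDeriv_eq_iterate]
  simp only [Function.iterate_succ, Function.iterate_zero, Function.comp_apply, id, zero_mul, zero_add]
  have e0 : (fun t : ℝ => Real.exp (v * t ^ 2 / 2)) = fun t => 1 * Real.exp (v * t ^ 2 / 2) := by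
    simp
  rw [e0, hd (fun _ => 1) (fun _ => 0) (fun t => hasDerivAt_const _ _),
    hd (fun t => 0 + v * t * 1) (fun _ => v) (fun t => by
      simpa using (hasDerivAt_id t).const_mul (v : ℝ)),
    hd (fun t => v + v * t * (0 + v * t * 1)) (fun t => 2 * (v : ℝ) ^ 2 * t) (fun t => by
      have h3 : (fun t : ℝ => v + v * t * (0 + v * t * 1)) = fun t => v + (v : ℝ) ^ 2 * t ^ 2 := by
        ext s; ring
      rw [h3]
      exact (((hasDerivAt_pow 2 t).const_mul ((v : ℝ) ^ 2)).const_add (v : ℝ)).congr_deriv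
        (by norm_num; ring)),
    hd (fun t => 2 * (v : ℝ) ^ 2 * t + v * t * (v + v * t * (0 + v * t * 1)))
      (fun t => 3 * (v : ℝ) ^ 2 + 3 * (v : ℝ) ^ 3 * t ^ 2) (fun t => by
      have h3 : (fun t : ℝ => 2 * (v : ℝ) ^ 2 * t + v * t * (v + v * t * (0 + v * t * 1))) =
          fun t => 3 * (v : ℝ) ^ 2 * t + (v : ℝ) ^ 3 * t ^ 3 := by
        ext s; ring
      rw [h3]
      exact (((hasDerivAt_id' t).const_mul (3 * (v : ℝ) ^ 2)).fun_add
        ((hasDerivAt_pow 3 t).const_mul ((v : ℝ) ^ 3))).congr_deriv (by norm_num; ring))]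
  simp

lemma integral_sq_gaussianReal (v : NNReal) : ∫ x, x ^ 2 ∂gaussianReal 0 v = v := by
  have h := variance_fun_id_gaussianReal (μ := 0) (v := v)
  rw [variance_of_integral_eq_zero (by fun_prop) (by simp)] at h
  exact h

variable {d : ℕ}

lemma map_dotProduct_gaussianVector (v : Fin d → ℝ) :
    (gaussianVector d).map (fun g => v ⬝ᵥ g) = gaussianReal 0 (Real.toNNReal (v ⬝ᵥ v)) := by
  have hm : Measurable fun g : Fin d → ℝ => v ⬝ᵥ g := by unfold dotProduct; fun_prop
  have := Measure.isProbabilityMeasure_map (μ := gaussianVector d) hm.aemeasurable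
  apply Measure.ext_of_charFun
  ext t
  rw [charFun_apply_real, integral_map hm.aemeasurable (by fun_prop), charFun_gaussianReal,
    gaussianVector]
  have : ∀ g : Fin d → ℝ, Complex.exp (t * ((v ⬝ᵥ g : ℝ) : ℂ) * Complex.I) =
      ∏ i, Complex.exp (((t * v i : ℝ) : ℂ) * (g i : ℂ) * Complex.I) := by
    intro g
    rw [← Complex.exp_sum]
    congr 1
    simp only [dotProduct, Complex.ofReal_sum, Complex.ofReal_mul, Finset.mul_sum, Finset.sum_mul]
    exact Finset.sum_congr rfl fun i _ => by ring
  simp_rw [this]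
  rw [integral_fintype_prod_eq_prod
    (f := fun i (x : ℝ) => Complex.exp (((t * v i : ℝ) : ℂ) * (x : ℂ) * Complex.I))]
  simp_rw [← charFun_apply_real, charFun_gaussianReal]
  rw [← Complex.exp_sum, Real.coe_toNNReal _ (by
    exact Finset.sum_nonneg fun i _ => mul_self_nonneg (v i))]
  congr 1
  simp only [dotProduct, Complex.ofReal_sum, Complex.ofReal_mul, Complex.ofReal_zero, mul_zero,
    zero_mul, zero_sub, Finset.sum_mul, Finset.sum_div, Finset.sum_neg_distrib, NNReal.coe_one,
    Complex.ofReal_one, one_mul]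
  congr 1
  exact Finset.sum_congr rfl fun i _ => by ring

lemma memLp_dotProduct_gaussianVector (v : Fin d → ℝ) (p : ℝ≥0∞) (hp : p ≠ ∞) :
    MemLp (fun g => v ⬝ᵥ g) p (gaussianVector d) := by
  have hm : Measurable fun g : Fin d → ℝ => v ⬝ᵥ g := by unfold dotProduct; fun_prop
  have := memLp_id_gaussianReal' (μ := 0) (v := Real.toNNReal (v ⬝ᵥ v)) p hp
  rw [← map_dotProduct_gaussianVector] at this
  exact this.comp_of_map hm.aemeasurable

lemma dotProduct_self_nonneg' (v : Fin d → ℝ) : 0 ≤ v ⬝ᵥ v :=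
  Finset.sum_nonneg fun i _ => mul_self_nonneg (v i)

lemma integral_sq_dotProduct_gaussianVector (v : Fin d → ℝ) :
    ∫ g, (v ⬝ᵥ g) ^ 2 ∂gaussianVector d = v ⬝ᵥ v := by
  have hm : Measurable fun g : Fin d → ℝ => v ⬝ᵥ g := by unfold dotProduct; fun_prop
  rw [← integral_map (f := fun x => x ^ 2) hm.aemeasurable (by fun_prop),
    map_dotProduct_gaussianVector, integral_sq_gaussianReal,
    Real.coe_toNNReal _ (dotProduct_self_nonneg' v)]

lemma integral_pow_four_dotProduct_gaussianVector (v : Fin d → ℝ) :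
    ∫ g, (v ⬝ᵥ g) ^ 4 ∂gaussianVector d = 3 * (v ⬝ᵥ v) ^ 2 := by
  have hm : Measurable fun g : Fin d → ℝ => v ⬝ᵥ g := by unfold dotProduct; fun_prop
  rw [← integral_map (f := fun x => x ^ 4) hm.aemeasurable (by fun_prop),
    map_dotProduct_gaussianVector, integral_pow_four_gaussianReal,
    Real.coe_toNNReal _ (dotProduct_self_nonneg' v)]

lemma integrable_pow_dotProduct_gaussianVector (v : Fin d → ℝ) (n : ℕ) :
    Integrable (fun g => (v ⬝ᵥ g) ^ n) (gaussianVector d) := by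
  have hm : Measurable fun g : Fin d → ℝ => v ⬝ᵥ g := by unfold dotProduct; fun_prop
  have := (memLp_dotProduct_gaussianVector v n (by simp)).integrable_norm_pow'
  simp_rw [← norm_pow] at this
  exact (integrable_norm_iff (by fun_prop)).1 this

lemma integrable_dotProduct_mul_gaussianVector (v w : Fin d → ℝ) :
    Integrable (fun g => (v ⬝ᵥ g) * (w ⬝ᵥ g)) (gaussianVector d) :=
  (memLp_dotProduct_gaussianVector v 2 (by simp)).integrable_mul
    (memLp_dotProduct_gaussianVector w 2 (by simp))

lemma integral_dotProduct_mul_gaussianVector (v w : Fin d → ℝ) :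
    ∫ g, (v ⬝ᵥ g) * (w ⬝ᵥ g) ∂gaussianVector d = v ⬝ᵥ w := by
  have h : ∀ g : Fin d → ℝ, (v ⬝ᵥ g) * (w ⬝ᵥ g) =
      1 / 2 * (((v + w) ⬝ᵥ g) ^ 2 - ((v ⬝ᵥ g) ^ 2 + (w ⬝ᵥ g) ^ 2)) := by
    intro g; rw [add_dotProduct]; ring
  simp_rw [h]
  have hi := fun v : Fin d → ℝ => integrable_pow_dotProduct_gaussianVector v 2
  rw [integral_const_mul, integral_sub (hi _) ((hi _).fun_add (hi _)), integral_add (hi _) (hi _)]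
  simp only [integral_sq_dotProduct_gaussianVector]
  simp only [add_dotProduct, dotProduct_add, dotProduct_comm w v]
  ring

/-- Polarization reduces mixed fourth moments to fourth moments of single linear forms. -/
lemma sq_mul_sq_dotProduct_eq (v w g : Fin d → ℝ) : (v ⬝ᵥ g) ^ 2 * (w ⬝ᵥ g) ^ 2 =
      1 / 12 * (((v + w) ⬝ᵥ g) ^ 4 + ((v - w) ⬝ᵥ g) ^ 4 -
        (2 * (v ⬝ᵥ g) ^ 4 + 2 * (w ⬝ᵥ g) ^ 4)) := by
  rw [add_dotProduct, sub_dotProduct]; ring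

lemma integrable_sq_mul_sq_dotProduct_gaussianVector (v w : Fin d → ℝ) :
    Integrable (fun g => (v ⬝ᵥ g) ^ 2 * (w ⬝ᵥ g) ^ 2) (gaussianVector d) := by
  simp_rw [sq_mul_sq_dotProduct_eq]
  have hi := fun v : Fin d → ℝ => integrable_pow_dotProduct_gaussianVector v 4
  exact (((hi _).add (hi _)).sub (((hi _).const_mul _).add ((hi _).const_mul _))).const_mul _

lemma integral_sq_mul_sq_dotProduct_gaussianVector (v w : Fin d → ℝ) :
    ∫ g, (v ⬝ᵥ g) ^ 2 * (w ⬝ᵥ g) ^ 2 ∂gaussianVector d =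
      (v ⬝ᵥ v) * (w ⬝ᵥ w) + 2 * (v ⬝ᵥ w) ^ 2 := by
  simp_rw [sq_mul_sq_dotProduct_eq]
  have hi := fun v : Fin d → ℝ => integrable_pow_dotProduct_gaussianVector v 4
  rw [integral_const_mul,
    integral_sub ((hi _).fun_add (hi _)) (((hi _).const_mul _).fun_add ((hi _).const_mul _)),
    integral_add (hi _) (hi _), integral_add ((hi _).const_mul _) ((hi _).const_mul _),
    integral_const_mul, integral_const_mul]
  simp only [integral_pow_four_dotProduct_gaussianVector]
  simp only [add_dotProduct, dotProduct_add, sub_dotProduct, dotProduct_sub, dotProduct_comm w v]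
  ring

/-- The density of `v ⬝ᵥ g` is at most `1 / (2 a)`, because `2 π ≥ 4`, and the interval has length
`2 t a`. -/
lemma gaussianVector_abs_dotProduct_le {v : Fin d → ℝ} {a t : ℝ} (ha : 0 < a)
    (hv : a ^ 2 ≤ v ⬝ᵥ v) : gaussianVector d {g | |v ⬝ᵥ g| ≤ t * a} ≤ ENNReal.ofReal t := by
  have hm : Measurable fun g : Fin d → ℝ => v ⬝ᵥ g := by unfold dotProduct; fun_prop
  have h0 : 0 < v ⬝ᵥ v := lt_of_lt_of_le (by positivity) hv
  have h1 : {g : Fin d → ℝ | |v ⬝ᵥ g| ≤ t * a} = (fun g => v ⬝ᵥ g) ⁻¹' Set.Icc (-(t * a)) (t * a) := by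
    ext g; simp [abs_le]
  rw [h1, ← Measure.map_apply hm measurableSet_Icc, map_dotProduct_gaussianVector,
    gaussianReal_apply _ (by simpa using h0)]
  have hpdf : ∀ x, gaussianPDF 0 (Real.toNNReal (v ⬝ᵥ v)) x ≤ ENNReal.ofReal (1 / (2 * a)) := by
    intro x
    rw [gaussianPDF]
    apply ENNReal.ofReal_le_ofReal
    rw [gaussianPDFReal, Real.coe_toNNReal _ h0.le]
    have hexp : Real.exp (-(x - 0) ^ 2 / (2 * (v ⬝ᵥ v))) ≤ 1 := by
      rw [Real.exp_le_one_iff]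
      exact div_nonpos_of_nonpos_of_nonneg (by nlinarith) (by positivity)
    have hs : 2 * a ≤ √(2 * Real.pi * (v ⬝ᵥ v)) := by
      apply Real.le_sqrt_of_sq_le
      nlinarith [Real.pi_gt_three]
    calc _ ≤ (√(2 * Real.pi * (v ⬝ᵥ v)))⁻¹ * 1 := by gcongr
      _ ≤ _ := by rw [mul_one, one_div]; gcongr
  calc _ ≤ ∫⁻ _ in Set.Icc (-(t * a)) (t * a), ENNReal.ofReal (1 / (2 * a)) :=
        lintegral_mono fun x => hpdf x
    _ = ENNReal.ofReal t := by
        rw [setLIntegral_const, Real.volume_Icc, ← ENNReal.ofReal_mul (by positivity)]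
        congr 1
        field_simp
        ring

end Gaussian

/-! ### Averaging quadratic polynomials over one step -/

section Averaging

variable {d : ℕ}

/-- The vectors `u i` form an orthonormal eigenbasis of the symmetric matrix `A` with eigenvalues
`l i`. -/
structure IsEigenSystem (A : Matrix (Fin d) (Fin d) ℝ) (l : Fin d → ℝ) (u : Fin d → Fin d → ℝ) :
    Prop where
  dotProduct_self : ∀ i, u i ⬝ᵥ u i = 1
  dotProduct_mulVec : ∀ i x, u i ⬝ᵥ A.mulVec x = l i * (u i ⬝ᵥ x)
  form_eq : ∀ x, x ⬝ᵥ A.mulVec x = ∑ i, l i * (u i ⬝ᵥ x) ^ 2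
  sq_eq : ∀ x, A.mulVec x ⬝ᵥ A.mulVec x = ∑ i, l i ^ 2 * (u i ⬝ᵥ x) ^ 2

/-- One step of the Oja-type iteration. -/
def ojaStep (A : Matrix (Fin d) (Fin d) ℝ) (η : ℝ) (g x : Fin d → ℝ) : Fin d → ℝ :=
  x - (η * (g ⬝ᵥ A.mulVec x)) • g

/-- The average of `f` after one step of the Oja-type iteration. -/
noncomputable def ojaAverage (A : Matrix (Fin d) (Fin d) ℝ) (η : ℝ) (f : (Fin d → ℝ) → ℝ≥0∞)
    (x : Fin d → ℝ) : ℝ≥0∞ :=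
  ∫⁻ g, f (ojaStep A η g x) ∂gaussianVector d

/-- A quadratic polynomial without mixed terms in the coordinates `u i ⬝ᵥ x`. -/
def quadPoly (u : Fin d → Fin d → ℝ) (c e : Fin d → ℝ) (f : ℝ) (x : Fin d → ℝ) : ℝ :=
  ∑ i, (c i * (u i ⬝ᵥ x) ^ 2 + e i * (u i ⬝ᵥ x)) + f

/-- The effect of averaging over one step on the quadratic coefficients. -/
def averageCoeff (l : Fin d → ℝ) (η : ℝ) (c : Fin d → ℝ) (j : Fin d) : ℝ :=
  (1 - 2 * η * l j + 2 * η ^ 2 * l j ^ 2) * c j + η ^ 2 * l j ^ 2 * ∑ i, c i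

variable {A : Matrix (Fin d) (Fin d) ℝ} {l : Fin d → ℝ} {u : Fin d → Fin d → ℝ}

lemma dotProduct_ojaStep (η : ℝ) (v g x : Fin d → ℝ) :
    v ⬝ᵥ ojaStep A η g x = v ⬝ᵥ x - η * ((A.mulVec x ⬝ᵥ g) * (v ⬝ᵥ g)) := by
  rw [ojaStep, dotProduct_sub, dotProduct_smul, smul_eq_mul, dotProduct_comm g]
  ring

lemma integrable_quadPoly_ojaStep (η : ℝ) (c e : Fin d → ℝ) (f : ℝ) (x : Fin d → ℝ) :
    Integrable (fun g => quadPoly u c e f (ojaStep A η g x)) (gaussianVector d) := by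
  simp only [quadPoly, dotProduct_ojaStep, sub_sq, mul_pow]
  refine (integrable_finsetSum _ fun i _ => ?_).add (integrable_const f)
  have h1 := integrable_dotProduct_mul_gaussianVector (A.mulVec x) (u i)
  have h2 := integrable_sq_mul_sq_dotProduct_gaussianVector (A.mulVec x) (u i)
  exact ((((integrable_const _).sub ((h1.const_mul η).const_mul _)).add (h2.const_mul _)).const_mul
    _).add (((integrable_const _).sub (h1.const_mul η)).const_mul _)

lemma integral_quadPoly_ojaStep (hA : IsEigenSystem A l u) (η : ℝ) (c e : Fin d → ℝ) (f : ℝ)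
    (x : Fin d → ℝ) :
    ∫ g, quadPoly u c e f (ojaStep A η g x) ∂gaussianVector d =
      quadPoly u (averageCoeff l η c) (fun j => (1 - η * l j) * e j) f x := by
  simp only [quadPoly, dotProduct_ojaStep, sub_sq, mul_pow]
  have h1 := fun i => integrable_dotProduct_mul_gaussianVector (A.mulVec x) (u i)
  have h2 := fun i => integrable_sq_mul_sq_dotProduct_gaussianVector (A.mulVec x) (u i)
  have hp : ∀ i, Integrable (fun g => (u i ⬝ᵥ x) ^ 2 -
      2 * (u i ⬝ᵥ x) * (η * ((A.mulVec x ⬝ᵥ g) * (u i ⬝ᵥ g)))) (gaussianVector d) :=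
    fun i => (integrable_const _).sub (((h1 i).const_mul η).const_mul _)
  have hq : ∀ i, Integrable (fun g => u i ⬝ᵥ x - η * ((A.mulVec x ⬝ᵥ g) * (u i ⬝ᵥ g)))
      (gaussianVector d) := fun i => (integrable_const _).sub ((h1 i).const_mul η)
  have hpq := fun i => (((hp i).fun_add ((h2 i).const_mul (η ^ 2))).const_mul (c i)).fun_add
    ((hq i).const_mul (e i))
  rw [integral_add (integrable_finsetSum _ fun i _ => hpq i) (integrable_const f),
    integral_finsetSum _ fun i _ => hpq i]
  have key : ∀ i, ∫ g, (c i * ((u i ⬝ᵥ x) ^ 2 -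
        2 * (u i ⬝ᵥ x) * (η * ((A.mulVec x ⬝ᵥ g) * (u i ⬝ᵥ g))) +
        η ^ 2 * ((A.mulVec x ⬝ᵥ g) ^ 2 * (u i ⬝ᵥ g) ^ 2)) +
        e i * ((u i ⬝ᵥ x) - η * ((A.mulVec x ⬝ᵥ g) * (u i ⬝ᵥ g)))) ∂gaussianVector d =
      (1 - 2 * η * l i + 2 * η ^ 2 * l i ^ 2) * c i * (u i ⬝ᵥ x) ^ 2 +
        (1 - η * l i) * e i * (u i ⬝ᵥ x) +
        η ^ 2 * c i * ∑ j, l j ^ 2 * (u j ⬝ᵥ x) ^ 2 := by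
    intro i
    rw [integral_add (((hp i).fun_add ((h2 i).const_mul (η ^ 2))).const_mul (c i))
      ((hq i).const_mul (e i)), integral_const_mul, integral_const_mul,
      integral_add (hp i) ((h2 i).const_mul (η ^ 2)),
      integral_sub (integrable_const _) (((h1 i).const_mul η).const_mul _),
      integral_sub (integrable_const _) ((h1 i).const_mul η)]
    simp only [integral_const_mul, integral_const, probReal_univ, one_smul,
      integral_dotProduct_mul_gaussianVector, integral_sq_mul_sq_dotProduct_gaussianVector]
    rw [dotProduct_comm (A.mulVec x) (u i), hA.dotProduct_mulVec, hA.dotProduct_self, hA.sq_eq]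
    ring
  rw [Finset.sum_congr rfl fun i _ => key i]
  simp only [integral_const, probReal_univ, one_smul]
  congr 1
  rw [Finset.sum_add_distrib, ← Finset.sum_mul, ← Finset.mul_sum, Finset.mul_sum,
    ← Finset.sum_add_distrib]
  refine Finset.sum_congr rfl fun i _ => ?_
  rw [averageCoeff]
  ring

lemma ojaAverage_quadPoly (hA : IsEigenSystem A l u) (η : ℝ) {c e : Fin d → ℝ} {f : ℝ}
    (h0 : ∀ x, 0 ≤ quadPoly u c e f x) :
    ojaAverage A η (fun x => ENNReal.ofReal (quadPoly u c e f x)) =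
      fun x => ENNReal.ofReal
        (quadPoly u (averageCoeff l η c) (fun j => (1 - η * l j) * e j) f x) := by
  ext x
  rw [ojaAverage, ← integral_quadPoly_ojaStep hA, ofReal_integral_eq_lintegral_ofReal
    (integrable_quadPoly_ojaStep η c e f x) (Filter.Eventually.of_forall fun g => h0 _)]

/-- Averages of nonnegative functions are nonnegative. This lets the coefficient formula pass
through `ENNReal.ofReal` at every iteration. -/
lemma quadPoly_iterate_nonneg (hA : IsEigenSystem A l u) (η : ℝ) (k : ℕ) {c e : Fin d → ℝ}
    {f : ℝ} (h0 : ∀ x, 0 ≤ quadPoly u c e f x) (x : Fin d → ℝ) :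
    0 ≤ quadPoly u ((averageCoeff l η)^[k] c) (fun j => (1 - η * l j) ^ k * e j) f x := by
  induction k generalizing x with
  | zero => simpa using h0 x
  | succ k ih =>
    have h := integral_quadPoly_ojaStep hA η ((averageCoeff l η)^[k] c)
      (fun j => (1 - η * l j) ^ k * e j) f x
    simp only [Function.iterate_succ_apply', pow_succ', mul_assoc]
    rw [← h]
    exact integral_nonneg fun g => ih _

lemma iterate_ojaAverage_quadPoly (hA : IsEigenSystem A l u) (η : ℝ) (k : ℕ) {c e : Fin d → ℝ}
    {f : ℝ} (h0 : ∀ x, 0 ≤ quadPoly u c e f x) :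
    (ojaAverage A η)^[k] (fun x => ENNReal.ofReal (quadPoly u c e f x)) =
      fun x => ENNReal.ofReal
        (quadPoly u ((averageCoeff l η)^[k] c) (fun j => (1 - η * l j) ^ k * e j) f x) := by
  induction k with
  | zero => simp
  | succ k ih =>
    rw [Function.iterate_succ_apply', ih, ojaAverage_quadPoly hA η (quadPoly_iterate_nonneg hA η k h0)]
    simp only [Function.iterate_succ_apply', pow_succ', mul_assoc]

/-- `averageCoeff` is the transpose of the linear recursion for `secondMoment`: evolving the test
polynomial backwards equals evolving the moments forwards. -/
lemma sum_iterate_averageCoeff (l : Fin d → ℝ) (η : ℝ) (n : ℕ) (c : Fin d → ℝ) :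
    ∑ j, (averageCoeff l η)^[n] c j = ∑ i, c i * secondMoment l η n i := by
  induction n generalizing c with
  | zero => simp [secondMoment]
  | succ n ih =>
    rw [Function.iterate_succ_apply, ih]
    have h : ∀ i, averageCoeff l η c i * secondMoment l η n i =
        c i * ((1 - 2 * η * l i + 2 * η ^ 2 * l i ^ 2) * secondMoment l η n i) +
          (l i ^ 2 * secondMoment l η n i) * (η ^ 2 * ∑ i, c i) := fun i => by
      rw [averageCoeff]; ring
    simp only [secondMoment_succ, h, mul_add, Finset.sum_add_distrib]
    rw [← Finset.sum_mul, ← Finset.sum_mul, energy]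
    ring

end Averaging

/-! ### Acceptance events, query counts and measurability of runs -/

section Run

variable {d : ℕ} {A : Matrix (Fin d) (Fin d) ℝ}

/-- No iterate of a run of the Oja-type iteration has a negative quadratic form. -/
def RunAccepts (A : Matrix (Fin d) (Fin d) ℝ) (η : ℝ) (N : ℕ) (g : Fin N → Fin d → ℝ)
    (x : Fin d → ℝ) : Prop :=
  (ojaRun η (.answer true) N g x).output A = true

lemma runAccepts_zero (η : ℝ) (g : Fin 0 → Fin d → ℝ) (x : Fin d → ℝ) :
    RunAccepts A η 0 g x ↔ 0 ≤ x ⬝ᵥ A.mulVec x := by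
  rw [RunAccepts, ojaRun, VMVAlgorithm.output]
  split_ifs with h <;> simp [VMVAlgorithm.output, h, not_le.2, not_lt.1]

lemma runAccepts_succ (η : ℝ) (N : ℕ) (g : Fin (N + 1) → Fin d → ℝ) (x : Fin d → ℝ) :
    RunAccepts A η (N + 1) g x ↔
      0 ≤ x ⬝ᵥ A.mulVec x ∧ RunAccepts A η N (Fin.tail g) (ojaStep A η (g 0) x) := by
  rw [RunAccepts, ojaRun, VMVAlgorithm.output]
  split_ifs with h
  · simp [VMVAlgorithm.output, not_le.2 h]
  · simp [VMVAlgorithm.output, not_lt.1 h, RunAccepts, ojaStep]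

lemma output_ojaRun (η : ℝ) (rest : VMVAlgorithm d) (N : ℕ) (g : Fin N → Fin d → ℝ)
    (x : Fin d → ℝ) :
    (ojaRun η rest N g x).output A = true ↔ RunAccepts A η N g x ∧ rest.output A = true := by
  induction N generalizing x with
  | zero =>
    rw [runAccepts_zero, ojaRun, VMVAlgorithm.output]
    split_ifs with h
    · simp [VMVAlgorithm.output, not_le.2 h]
    · simp [not_lt.1 h]
  | succ N ih =>
    rw [runAccepts_succ, ojaRun, VMVAlgorithm.output]
    split_ifs with h
    · simp [VMVAlgorithm.output, not_le.2 h]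
    · rw [VMVAlgorithm.output, ih]
      simp [not_lt.1 h, ojaStep]

lemma output_ojaRuns {N : ℕ} (R : ℕ) (η : Fin R → ℝ) (x : Fin R → Fin d → ℝ)
    (g : Fin R → Fin N → Fin d → ℝ) :
    (ojaRuns R η x g).output A = true ↔ ∀ r, RunAccepts A (η r) N (g r) (x r) := by
  induction R with
  | zero => simp [ojaRuns, VMVAlgorithm.output]
  | succ R ih =>
    rw [ojaRuns, output_ojaRun, ih, Fin.forall_fin_succ]
    rfl

lemma output_probe (k : ℕ) (v w : Fin k → Fin d → ℝ) (next : (Fin k → ℝ) → VMVAlgorithm d) :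
    (probe k v w next).output A = (next fun i => v i ⬝ᵥ A.mulVec (w i)).output A := by
  induction k with
  | zero =>
    rw [probe]
    congr 2
    exact Subsingleton.elim _ _
  | succ k ih =>
    rw [probe, VMVAlgorithm.output, ih]
    congr 2
    funext i
    refine Fin.cases ?_ (fun j => ?_) i <;> simp [Fin.tail]

lemma runAccepts_of_nonneg (hA : ∀ x : Fin d → ℝ, 0 ≤ x ⬝ᵥ A.mulVec x) (η : ℝ) (N : ℕ)
    (g : Fin N → Fin d → ℝ) (x : Fin d → ℝ) : RunAccepts A η N g x := by
  induction N generalizing x with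
  | zero => exact (runAccepts_zero η g x).2 (hA x)
  | succ N ih => exact (runAccepts_succ η N g x).2 ⟨hA x, ih _ _⟩

lemma numQueries_ojaRun_le (η : ℝ) (rest : VMVAlgorithm d) (N : ℕ) (g : Fin N → Fin d → ℝ)
    (x : Fin d → ℝ) :
    (ojaRun η rest N g x).numQueries A ≤ 2 * N + 1 + rest.numQueries A := by
  induction N generalizing x with
  | zero =>
    rw [ojaRun, VMVAlgorithm.numQueries]
    split_ifs <;> simp [VMVAlgorithm.numQueries]
  | succ N ih =>
    rw [ojaRun, VMVAlgorithm.numQueries]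
    split_ifs
    · simp only [VMVAlgorithm.numQueries]
      omega
    · rw [VMVAlgorithm.numQueries]
      have := ih (Fin.tail g) (x - (η * (g 0 ⬝ᵥ A.mulVec x)) • g 0)
      omega

lemma numQueries_ojaRuns_le {N : ℕ} (R : ℕ) (η : Fin R → ℝ) (x : Fin R → Fin d → ℝ)
    (g : Fin R → Fin N → Fin d → ℝ) :
    (ojaRuns R η x g).numQueries A ≤ R * (2 * N + 1) := by
  induction R with
  | zero => simp [ojaRuns, VMVAlgorithm.numQueries]
  | succ R ih =>
    rw [ojaRuns]
    refine (numQueries_ojaRun_le _ _ _ _ _).trans ?_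
    have := ih (Fin.tail η) (Fin.tail x) (Fin.tail g)
    linarith

lemma numQueries_probe (k : ℕ) (v w : Fin k → Fin d → ℝ) (next : (Fin k → ℝ) → VMVAlgorithm d) :
    (probe k v w next).numQueries A =
      (next fun i => v i ⬝ᵥ A.mulVec (w i)).numQueries A + k := by
  induction k with
  | zero =>
    rw [probe]
    congr 2
    exact Subsingleton.elim _ _
  | succ k ih =>
    rw [probe, VMVAlgorithm.numQueries, ih, add_assoc]
    congr 3
    funext i
    refine Fin.cases ?_ (fun j => ?_) i <;> simp [Fin.tail]

lemma measurable_form : Measurable fun x : Fin d → ℝ => x ⬝ᵥ A.mulVec x := by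
  unfold Matrix.mulVec dotProduct; fun_prop

lemma measurable_ojaStep :
    Measurable fun p : ℝ × (Fin d → ℝ) × (Fin d → ℝ) => ojaStep A p.1 p.2.1 p.2.2 := by
  unfold ojaStep Matrix.mulVec dotProduct; fun_prop

lemma measurableSet_runAccepts (A : Matrix (Fin d) (Fin d) ℝ) (N : ℕ) :
    MeasurableSet {p : ℝ × (Fin N → Fin d → ℝ) × (Fin d → ℝ) | RunAccepts A p.1 N p.2.1 p.2.2} := by
  induction N with
  | zero =>
    simp only [runAccepts_zero]
    exact measurableSet_le measurable_const (measurable_form.comp (by fun_prop))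
  | succ N ih =>
    simp only [runAccepts_succ, Set.ofPred_and]
    refine (measurableSet_le measurable_const (measurable_form.comp (by fun_prop))).inter ?_
    have hm : Measurable fun p : ℝ × (Fin (N + 1) → Fin d → ℝ) × (Fin d → ℝ) =>
        (p.1, Fin.tail p.2.1, ojaStep A p.1 (p.2.1 0) p.2.2) := by
      refine measurable_fst.prodMk (Measurable.prodMk ?_ ?_)
      · unfold Fin.tail; fun_prop
      · exact measurable_ojaStep.comp (f := fun p : ℝ × (Fin (N + 1) → Fin d → ℝ) × (Fin d → ℝ) =>
          (p.1, p.2.1 0, p.2.2)) (by fun_prop)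
    exact hm ih

/-- Only the sign test at the `k`-th iterate is kept. The function `h` majorizes the indicator of
passing it, and the Markov property turns the expectation into iterated averages. -/
lemma measure_runAccepts_le (η : ℝ) {h : (Fin d → ℝ) → ℝ≥0∞}
    (hh : ∀ x, 0 ≤ x ⬝ᵥ A.mulVec x → 1 ≤ h x) {k N : ℕ} (hk : k ≤ N) (x : Fin d → ℝ) :
    (Measure.pi fun _ : Fin N => gaussianVector d) {g | RunAccepts A η N g x} ≤
      (ojaAverage A η)^[k] h x := by
  induction N generalizing k x with
  | zero =>
    obtain rfl : k = 0 := by omega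
    simp only [runAccepts_zero, Function.iterate_zero, id]
    by_cases hx : 0 ≤ x ⬝ᵥ A.mulVec x
    · exact prob_le_one.trans (hh x hx)
    · simp [hx]
  | succ N ih =>
    cases k with
    | zero =>
      simp only [Function.iterate_zero, id]
      by_cases hx : 0 ≤ x ⬝ᵥ A.mulVec x
      · exact prob_le_one.trans (hh x hx)
      · simp [runAccepts_succ, hx]
    | succ k =>
      have hmp := measurePreserving_piFinSuccAbove (fun _ : Fin (N + 1) => gaussianVector d) 0
      have hms : MeasurableSet {p : (Fin d → ℝ) × (Fin N → Fin d → ℝ) |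
          RunAccepts A η N p.2 (ojaStep A η p.1 x)} := by
        have hm : Measurable fun p : (Fin d → ℝ) × (Fin N → Fin d → ℝ) =>
            (η, p.2, ojaStep A η p.1 x) := by
          refine measurable_const.prodMk (measurable_snd.prodMk ?_)
          exact measurable_ojaStep.comp (f := fun p : (Fin d → ℝ) × (Fin N → Fin d → ℝ) =>
            (η, p.1, x)) (by fun_prop)
        exact hm (measurableSet_runAccepts A N)
      calc _ ≤ (Measure.pi fun _ : Fin (N + 1) => gaussianVector d)
            (MeasurableEquiv.piFinSuccAbove (fun _ => Fin d → ℝ) 0 ⁻¹' {p |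
              RunAccepts A η N p.2 (ojaStep A η p.1 x)}) := by
            refine measure_mono fun g hg => ?_
            exact ((runAccepts_succ η N g x).1 hg).2
        _ = ∫⁻ a, (Measure.pi fun _ : Fin N => gaussianVector d)
            {g | RunAccepts A η N g (ojaStep A η a x)} ∂gaussianVector d := by
            rw [hmp.measure_preimage hms.nullMeasurableSet, Measure.prod_apply hms]
            rfl
        _ ≤ ∫⁻ a, (ojaAverage A η)^[k] h (ojaStep A η a x) ∂gaussianVector d :=
            lintegral_mono fun a => ih (by omega) _
        _ = _ := by rw [Function.iterate_succ_apply', ojaAverage]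

end Run

/-! ### Acceptance probability of one run -/

section SingleRun

variable {d : ℕ} {A : Matrix (Fin d) (Fin d) ℝ} {l : Fin d → ℝ} {u : Fin d → Fin d → ℝ}

lemma max_mul_pow_eq (r η : ℝ) (n : ℕ) :
    max (-r) 0 * ((1 - η * r) ^ n) ^ 2 = max (-r) 0 * ((1 + η * max (-r) 0) ^ 2) ^ n := by
  rcases le_or_gt 0 r with h | h
  · simp [max_eq_right (neg_nonpos.2 h)]
  · rw [max_eq_left (by linarith), ← pow_mul, ← pow_mul, mul_comm n 2]
    ring_nf

lemma max_add_max_eq_abs (r : ℝ) : max r 0 + max (-r) 0 = |r| := by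
  rcases le_total 0 r with h | h
  · rw [abs_of_nonneg h, max_eq_left h, max_eq_right (by linarith), add_zero]
  · rw [abs_of_nonpos h, max_eq_right h, max_eq_left (by linarith), zero_add]

lemma max_sub_max_eq (r : ℝ) : max r 0 - max (-r) 0 = r := by
  rcases le_total 0 r with h | h
  · rw [max_eq_left h, max_eq_right (by linarith), sub_zero]
  · rw [max_eq_right h, max_eq_left (by linarith)]; ring

/-- If the quadratic form is nonnegative at `x`, then the positive part of the form or the deviation
of the negative coordinates of `x` from `b` is large. -/
lemma half_sum_le_of_form_nonneg (hA : IsEigenSystem A l u) {x : Fin d → ℝ} (b : Fin d → ℝ)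
    (hx : 0 ≤ x ⬝ᵥ A.mulVec x) :
    (∑ i, max (-l i) 0 * b i ^ 2) / 2 ≤
      ∑ i, (max (l i) 0 * (u i ⬝ᵥ x) ^ 2 + max (-l i) 0 * (u i ⬝ᵥ x - b i) ^ 2) := by
  rw [hA.form_eq] at hx
  have h1 : ∀ i, max (-l i) 0 * b i ^ 2 / 2 ≤ max (l i) 0 * (u i ⬝ᵥ x) ^ 2 +
      max (-l i) 0 * (u i ⬝ᵥ x - b i) ^ 2 - l i * (u i ⬝ᵥ x) ^ 2 := by
    intro i
    have h2 : 0 ≤ max (-l i) 0 * (2 * (u i ⬝ᵥ x) - b i) ^ 2 := by positivity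
    have h3 := max_sub_max_eq (l i)
    have h4 : max (l i) 0 = l i + max (-l i) 0 := by linarith
    rw [h4]
    nlinarith
  have h5 := Finset.sum_le_sum fun i (_ : i ∈ Finset.univ) => h1 i
  rw [Finset.sum_sub_distrib, ← Finset.sum_div] at h5
  linarith

/-- The polynomial in the starting point that bounds the probability of acceptance from good
starting points, up to a constant factor. -/
def noisePoly (l : Fin d → ℝ) (u : Fin d → Fin d → ℝ) (η C : ℝ) (n : ℕ) (x : Fin d → ℝ) : ℝ :=
  ∑ i, ((averageCoeff l η)^[n] (fun i => C * |l i|) i -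
    C * (max (-l i) 0 * ((1 + η * max (-l i) 0) ^ 2) ^ n)) * (u i ⬝ᵥ x) ^ 2

/-- The quadratic polynomial in `y` that is large where the form is nonnegative, for the starting
point `x`. -/
def deviationPoly (l : Fin d → ℝ) (u : Fin d → Fin d → ℝ) (η C : ℝ) (n : ℕ) (x : Fin d → ℝ) :
    (Fin d → ℝ) → ℝ :=
  quadPoly u (fun i => C * |l i|)
    (fun i => -2 * C * max (-l i) 0 * ((1 - η * l i) ^ n * (u i ⬝ᵥ x)))
    (C * ∑ i, max (-l i) 0 * ((1 - η * l i) ^ n * (u i ⬝ᵥ x)) ^ 2)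

lemma deviationPoly_eq (l : Fin d → ℝ) (u : Fin d → Fin d → ℝ) (η C : ℝ) (n : ℕ)
    (x y : Fin d → ℝ) :
    deviationPoly l u η C n x y = C * ∑ i, (max (l i) 0 * (u i ⬝ᵥ y) ^ 2 +
      max (-l i) 0 * (u i ⬝ᵥ y - (1 - η * l i) ^ n * (u i ⬝ᵥ x)) ^ 2) := by
  rw [deviationPoly, quadPoly, Finset.mul_sum, Finset.mul_sum, ← Finset.sum_add_distrib]
  refine Finset.sum_congr rfl fun i _ => ?_
  rw [← max_add_max_eq_abs]
  ring

lemma deviationPoly_nonneg (l : Fin d → ℝ) (u : Fin d → Fin d → ℝ) (η : ℝ) {C : ℝ} (hC : 0 ≤ C)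
    (n : ℕ) (x y : Fin d → ℝ) : 0 ≤ deviationPoly l u η C n x y := by
  rw [deviationPoly_eq]
  exact mul_nonneg hC (Finset.sum_nonneg fun i _ => by positivity)

/-- This is the identity "variance equals second moment minus squared mean": the deviation is
centred at the conditional mean, so the linear and constant terms combine to minus the squared mean.
-/
lemma quadPoly_iterate_eq_noisePoly (l : Fin d → ℝ) (u : Fin d → Fin d → ℝ) (η C : ℝ) (n : ℕ)
    (x : Fin d → ℝ) :
    quadPoly u ((averageCoeff l η)^[n] fun i => C * |l i|)
      (fun i => (1 - η * l i) ^ n * (-2 * C * max (-l i) 0 * ((1 - η * l i) ^ n * (u i ⬝ᵥ x))))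
      (C * ∑ i, max (-l i) 0 * ((1 - η * l i) ^ n * (u i ⬝ᵥ x)) ^ 2) x =
      noisePoly l u η C n x := by
  rw [quadPoly, noisePoly, Finset.mul_sum, ← Finset.sum_add_distrib]
  refine Finset.sum_congr rfl fun i _ => ?_
  rw [← max_mul_pow_eq]
  ring

lemma measure_runAccepts_le_noisePoly (hA : IsEigenSystem A l u) (η : ℝ) {C : ℝ} (hC : 0 ≤ C)
    {n N : ℕ} (hn : n ≤ N) (x : Fin d → ℝ)
    (hx : 2 ≤ C * ∑ i, max (-l i) 0 * ((1 + η * max (-l i) 0) ^ 2) ^ n * (u i ⬝ᵥ x) ^ 2) :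
    (Measure.pi fun _ : Fin N => gaussianVector d) {g | RunAccepts A η N g x} ≤
      ENNReal.ofReal (noisePoly l u η C n x) := by
  have h1 := measure_runAccepts_le (A := A) η
    (h := fun y => ENNReal.ofReal (deviationPoly l u η C n x y)) (fun y hy => by
      rw [← ENNReal.ofReal_one]
      apply ENNReal.ofReal_le_ofReal
      have h2 := mul_le_mul_of_nonneg_left (half_sum_le_of_form_nonneg hA
        (fun i => (1 - η * l i) ^ n * (u i ⬝ᵥ x)) hy) hC
      simp only [mul_pow, ← mul_assoc, max_mul_pow_eq] at h2
      rw [deviationPoly_eq]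
      simp only [mul_assoc] at hx h2 ⊢
      linarith) hn x
  unfold deviationPoly at h1
  rw [iterate_ojaAverage_quadPoly hA η n (deviationPoly_nonneg l u η hC n x)] at h1
  beta_reduce at h1
  rwa [quadPoly_iterate_eq_noisePoly] at h1

lemma integral_noisePoly (hA : IsEigenSystem A l u) (η C : ℝ) (n : ℕ) :
    ∫ x, noisePoly l u η C n x ∂gaussianVector d =
      C * (∑ i, |l i| * secondMoment l η n i - negGrowth l η n) := by
  unfold noisePoly
  rw [integral_finsetSum _ fun i _ =>
    (integrable_pow_dotProduct_gaussianVector (u i) 2).const_mul _]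
  simp only [integral_const_mul, integral_sq_dotProduct_gaussianVector, hA.dotProduct_self, mul_one,
    Finset.sum_sub_distrib, sum_iterate_averageCoeff, ← Finset.mul_sum, mul_assoc, negGrowth]
  ring

lemma integrable_noisePoly (η C : ℝ) (n : ℕ) :
    Integrable (noisePoly l u η C n) (gaussianVector d) := by
  unfold noisePoly
  exact integrable_finsetSum _ fun i _ =>
    (integrable_pow_dotProduct_gaussianVector (u i) 2).const_mul _

lemma noisePoly_nonneg (hA : IsEigenSystem A l u) (η : ℝ) {C : ℝ} (hC : 0 ≤ C) (n : ℕ)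
    (x : Fin d → ℝ) : 0 ≤ noisePoly l u η C n x := by
  rw [← quadPoly_iterate_eq_noisePoly]
  exact quadPoly_iterate_nonneg hA η n (deviationPoly_nonneg l u η hC n x) x

/-- From good starting points the acceptance probability is bounded by the averaged noise, and most
starting points are good. -/
lemma lintegral_measure_runAccepts_le (hA : IsEigenSystem A l u) (η : ℝ) {n N : ℕ} (hn : n ≤ N)
    {t θ : ℝ} (ht : 0 < t) (hW : 0 < negGrowth l η n)
    (hθ : ∑ i, |l i| * secondMoment l η n i ≤ (1 + θ) * negGrowth l η n) :
    ∫⁻ x, (Measure.pi fun _ : Fin N => gaussianVector d) {g | RunAccepts A η N g x}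
      ∂gaussianVector d ≤ ENNReal.ofReal (2 * t) + ENNReal.ofReal (4 * θ / t ^ 2) := by
  set W := negGrowth l η n with hWdef
  set w : Fin d → ℝ := fun i => max (-l i) 0 * ((1 + η * max (-l i) 0) ^ 2) ^ n with hw
  have hw0 : ∀ i, 0 ≤ w i := fun i => by rw [hw]; positivity
  have hWw : W = ∑ i, w i := rfl
  -- With this `C` the threshold `2` means that the weighted square sum is at least `t ^ 2 * W / 2`,
  -- which defines a good starting point.
  set C : ℝ := 4 / (t ^ 2 * W) with hC
  have hC0 : 0 ≤ C := by rw [hC]; positivity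
  have hmeas : ∀ i, MeasurableSet {x : Fin d → ℝ | |u i ⬝ᵥ x| ≤ t} := fun i => by
    refine measurableSet_le ?_ measurable_const
    unfold dotProduct; fun_prop
  -- At a bad starting point, the coordinates of absolute value at most `t` carry at least half of
  -- the weight `W`, so the indicator sum is at least `1`. Its mean is at most `2 * t` by
  -- anti-concentration of each coordinate, without any independence between them.
  have hpt : ∀ x, (Measure.pi fun _ : Fin N => gaussianVector d) {g | RunAccepts A η N g x} ≤
      ∑ i, ENNReal.ofReal (2 * w i / W) * {x : Fin d → ℝ | |u i ⬝ᵥ x| ≤ t}.indicator 1 x +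
        ENNReal.ofReal (noisePoly l u η C n x) := by
    intro x
    by_cases hx : 2 ≤ C * ∑ i, w i * (u i ⬝ᵥ x) ^ 2
    · exact (measure_runAccepts_le_noisePoly hA η hC0 hn x hx).trans le_add_self
    refine prob_le_one.trans (le_add_right ?_)
    have h1 : ∀ i, ENNReal.ofReal (2 * w i / W) *
        {x : Fin d → ℝ | |u i ⬝ᵥ x| ≤ t}.indicator 1 x =
        ENNReal.ofReal (2 * w i / W * {x : Fin d → ℝ | |u i ⬝ᵥ x| ≤ t}.indicator 1 x) := by
      intro i
      by_cases hi : x ∈ {x : Fin d → ℝ | |u i ⬝ᵥ x| ≤ t}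
      · simp only [Set.indicator_of_mem hi, Pi.one_apply, mul_one]
      · simp only [Set.indicator_of_notMem hi, mul_zero, ENNReal.ofReal_zero]
    rw [Finset.sum_congr rfl fun i _ => h1 i, ← ENNReal.ofReal_sum_of_nonneg fun i _ =>
      mul_nonneg (by have := hw0 i; positivity) (Set.indicator_nonneg (by simp) _),
      ← ENNReal.ofReal_one]
    apply ENNReal.ofReal_le_ofReal
    have h2 : ∑ i, w i * (u i ⬝ᵥ x) ^ 2 < t ^ 2 * W / 2 := by
      rw [not_le, hC, div_mul_eq_mul_div, div_lt_iff₀ (by positivity)] at hx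
      linarith
    have h3 : ∀ i, t ^ 2 * w i ≤ w i * (u i ⬝ᵥ x) ^ 2 +
        t ^ 2 * (w i * {x : Fin d → ℝ | |u i ⬝ᵥ x| ≤ t}.indicator 1 x) := by
      intro i
      by_cases hi : x ∈ {x : Fin d → ℝ | |u i ⬝ᵥ x| ≤ t}
      · simp only [Set.indicator_of_mem hi, Pi.one_apply, mul_one]
        have := mul_nonneg (hw0 i) (sq_nonneg (u i ⬝ᵥ x))
        linarith
      · simp only [Set.indicator_of_notMem hi, mul_zero, add_zero]
        rw [Set.mem_ofPred_eq, not_le] at hi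
        have h4 : t ^ 2 ≤ (u i ⬝ᵥ x) ^ 2 := by
          rw [← sq_abs (u i ⬝ᵥ x)]
          exact pow_le_pow_left₀ ht.le hi.le 2
        have := mul_le_mul_of_nonneg_left h4 (hw0 i)
        linarith
    have h5 := Finset.sum_le_sum fun i (_ : i ∈ Finset.univ) => h3 i
    rw [Finset.sum_add_distrib, ← Finset.mul_sum, ← Finset.mul_sum, ← hWw] at h5
    have h6 : ∑ i, 2 * w i / W * {x : Fin d → ℝ | |u i ⬝ᵥ x| ≤ t}.indicator 1 x =
        2 / W * ∑ i, w i * {x : Fin d → ℝ | |u i ⬝ᵥ x| ≤ t}.indicator 1 x := by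
      rw [Finset.mul_sum]
      exact Finset.sum_congr rfl fun i _ => by ring
    rw [h6, div_mul_eq_mul_div, le_div_iff₀ hW, one_mul]
    have h7 : 0 < t ^ 2 := by positivity
    nlinarith
  refine (lintegral_mono hpt).trans ?_
  have hint : ∀ i, ∫⁻ x, ENNReal.ofReal (2 * w i / W) *
      {x : Fin d → ℝ | |u i ⬝ᵥ x| ≤ t}.indicator 1 x ∂gaussianVector d ≤
      ENNReal.ofReal (2 * w i / W * t) := by
    intro i
    rw [lintegral_const_mul _ (measurable_one.indicator (hmeas i)),
      lintegral_indicator_one (hmeas i),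
      ENNReal.ofReal_mul (by have := hw0 i; positivity)]
    gcongr
    have := gaussianVector_abs_dotProduct_le (v := u i) (a := 1) (t := t) one_pos
      (by rw [hA.dotProduct_self]; norm_num)
    simpa using this
  rw [lintegral_add_left (Finset.measurable_sum _ fun i _ =>
    (measurable_one.indicator (hmeas i)).const_mul _), lintegral_finsetSum _ fun i _ =>
    (measurable_one.indicator (hmeas i)).const_mul _,
    ← ofReal_integral_eq_lintegral_ofReal (integrable_noisePoly η C n)
      (Filter.Eventually.of_forall fun x => noisePoly_nonneg hA η hC0 n x), integral_noisePoly hA]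
  refine add_le_add ((Finset.sum_le_sum fun i _ => hint i).trans ?_)
    (ENNReal.ofReal_le_ofReal ?_)
  · rw [← ENNReal.ofReal_sum_of_nonneg fun i _ => by have := hw0 i; positivity]
    apply ENNReal.ofReal_le_ofReal
    rw [← Finset.sum_mul, ← Finset.sum_div, ← Finset.mul_sum, ← hWw, mul_div_assoc,
      div_self hW.ne', mul_one]
  · calc _ ≤ C * (θ * W) := mul_le_mul_of_nonneg_left (by linarith) hC0
      _ = _ := by rw [hC]; field_simp

end SingleRun

/-! ### Choice of step size and run length -/

section Parameters

/-- The upper bound for the product of the step size and the Schatten `1`-norm. -/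
noncomputable def stepScale (ε : ℝ) : ℝ := 2⁻¹ ^ 24 / (26 * Real.log (2 / ε))

/-- The number of steps in a run. -/
noncomputable def runLength (ε : ℝ) : ℕ := ⌊52 * Real.log (2 / ε) / (stepScale ε * ε)⌋₊

lemma log_two_le_log_two_div {ε : ℝ} (h0 : 0 < ε) (h1 : ε < 1) :
    Real.log 2 ≤ Real.log (2 / ε) :=
  Real.log_le_log two_pos (by rw [le_div_iff₀ h0]; linarith)

lemma half_le_log_two_div {ε : ℝ} (h0 : 0 < ε) (h1 : ε < 1) : 1 / 2 ≤ Real.log (2 / ε) := by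
  have := log_two_le_log_two_div h0 h1
  have := Real.log_two_gt_d9
  linarith

lemma stepScale_pos {ε : ℝ} (h0 : 0 < ε) (h1 : ε < 1) : 0 < stepScale ε := by
  have := half_le_log_two_div h0 h1
  unfold stepScale
  positivity

variable {d : ℕ} {A : Matrix (Fin d) (Fin d) ℝ} {l : Fin d → ℝ} {u : Fin d → Fin d → ℝ}

lemma exp_mul_le_negGrowth {η μ : ℝ} (hη : 0 ≤ η) (hμ0 : 0 ≤ μ) (hημ : η * μ ≤ 1)
    (hμ : ∃ i, l i = -μ) (n : ℕ) : μ * Real.exp (n * (η * μ)) ≤ negGrowth l η n := by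
  obtain ⟨i, hi⟩ := hμ
  have h1 : μ * ((1 + η * μ) ^ 2) ^ n ≤ negGrowth l η n := by
    have := Finset.single_le_sum (f := fun i => max (-l i) 0 * ((1 + η * max (-l i) 0) ^ 2) ^ n)
      (fun j _ => by positivity) (Finset.mem_univ i)
    rw [negGrowth]
    simpa only [hi, neg_neg, max_eq_left hμ0] using this
  refine le_trans (mul_le_mul_of_nonneg_left ?_ hμ0) h1
  -- It remains to compare one step: `exp z ≤ 1 + z + z ^ 2 ≤ (1 + z) ^ 2` for `0 ≤ z ≤ 1`.
  rw [Real.exp_nat_mul]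
  refine pow_le_pow_left₀ (Real.exp_pos _).le ?_ n
  have h0 : 0 ≤ η * μ := mul_nonneg hη hμ0
  have := (abs_le.1 (Real.abs_exp_sub_one_sub_id_le (x := η * μ) (by rw [abs_of_nonneg h0]; exact hημ))).2
  nlinarith

/-- A run with a step size of the right order rejects with probability at least `5/6`. -/
lemma lintegral_measure_runAccepts_le_sixth (hA : IsEigenSystem A l u) {ε S μ η : ℝ} (hε0 : 0 < ε)
    (hε1 : ε < 1) (hS0 : 0 < S) (hS : ∑ i, |l i| ≤ S) (hμS : ε * S ≤ μ) (hμ : ∀ i, -l i ≤ μ)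
    (hμl : ∃ i, l i = -μ) (hη1 : stepScale ε / 2 ≤ η * S) (hη2 : η * S ≤ stepScale ε) :
    ∫⁻ x, (Measure.pi fun _ : Fin (runLength ε) => gaussianVector d)
      {g | RunAccepts A η (runLength ε) g x} ∂gaussianVector d ≤ ENNReal.ofReal (1 / 6) := by
  have hL := half_le_log_two_div hε0 hε1
  have hc := stepScale_pos hε0 hε1
  have hcL : 26 * Real.log (2 / ε) * stepScale ε = 2⁻¹ ^ 24 := by
    unfold stepScale; field_simp
  set L := Real.log (2 / ε) with hLdef
  set c := stepScale ε with hcdef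
  have hcle : c ≤ 2⁻¹ ^ 24 := by rw [← hcL]; nlinarith
  have hη : 0 < η := pos_of_mul_pos_left (lt_of_lt_of_le (by positivity) hη1) hS0.le
  have hμ0 : 0 < μ := lt_of_lt_of_le (by positivity) hμS
  have hμS' : μ ≤ S := by
    obtain ⟨i, hi⟩ := hμl
    have := Finset.single_le_sum (f := fun j => |l j|) (fun j _ => abs_nonneg _) (Finset.mem_univ i)
    simp only [hi, abs_neg, abs_of_pos hμ0] at this
    linarith
  have hημ0 : 0 < η * μ := mul_pos hη hμ0
  have hημS : η * μ ≤ η * S := mul_le_mul_of_nonneg_left hμS' hη.le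
  have hsmall : (2⁻¹ : ℝ) ^ 24 ≤ 1 / 1133568 := by norm_num
  have hημ1 : η * μ ≤ 1 := by linarith
  set T := Real.log (2 ^ 24 / ε) with hT
  have hTL : T ≤ 24 * L := by
    have h1 : (2 : ℝ) ^ 24 / ε = 2 ^ 23 * (2 / ε) := by ring
    rw [hT, h1, Real.log_mul (by positivity) (by positivity), Real.log_pow]
    have := log_two_le_log_two_div hε0 hε1
    push_cast
    linarith
  have hT0 : 0 ≤ T := Real.log_nonneg (by rw [le_div_iff₀ hε0]; linarith)
  -- The least time with `exp (n η μ) ≥ 2 ^ 24 / ε`, which makes the growth exceed `2 ^ 24 * S`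
  -- since `μ ≥ ε S`. It depends on the unknown `μ`, so the run only has to be long enough to
  -- contain it.
  set n := ⌈T / (η * μ)⌉₊ with hn
  have hn1 : T ≤ n * (η * μ) := (div_le_iff₀ hημ0).1 (Nat.le_ceil _)
  have hn2 : n * (η * μ) ≤ 26 * L := by
    have h1 : (n : ℝ) < T / (η * μ) + 1 := Nat.ceil_lt_add_one (by positivity)
    have h2 := mul_le_mul_of_nonneg_right h1.le hημ0.le
    rw [add_mul, div_mul_cancel₀ _ hημ0.ne', one_mul] at h2
    linarith
  -- The logarithm in the denominator of `stepScale` is there to cancel the `26 * L` of `hn2`.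
  have hn3 : n * (η * μ) * (η * S) ≤ 2⁻¹ ^ 24 := by
    rw [← hcL]
    exact mul_le_mul hn2 hη2 (by positivity) (by positivity)
  have hgrow : S ≤ 2⁻¹ ^ 24 * negGrowth l η n := by
    have h1 := exp_mul_le_negGrowth hη.le hμ0.le hημ1 hμl n
    have h2 : 2 ^ 24 / ε ≤ Real.exp (n * (η * μ)) := by
      rw [← Real.exp_log (by positivity : (0 : ℝ) < 2 ^ 24 / ε)]
      exact Real.exp_le_exp.2 hn1
    have h3 : 2 ^ 24 * S ≤ negGrowth l η n := by
      calc 2 ^ 24 * S = (ε * S) * (2 ^ 24 / ε) := by field_simp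
        _ ≤ μ * Real.exp (n * (η * μ)) := mul_le_mul hμS h2 (by positivity) hμ0.le
        _ ≤ _ := h1
    calc S = 2⁻¹ ^ 24 * (2 ^ 24 * S) := by rw [← mul_assoc]; norm_num
      _ ≤ _ := by gcongr
  have hnN : n ≤ runLength ε := by
    rw [runLength, Nat.le_floor_iff (by positivity), le_div_iff₀ (by positivity)]
    have h1 : c / 2 * ε ≤ η * μ :=
      calc c / 2 * ε ≤ η * S * ε := by gcongr
        _ = η * (ε * S) := by ring
        _ ≤ η * μ := by gcongr
    have h2 := mul_le_mul_of_nonneg_left h1 (Nat.cast_nonneg (α := ℝ) n)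
    linarith
  have hW : 0 < negGrowth l η n := by
    by_contra h
    have : (2⁻¹ : ℝ) ^ 24 * negGrowth l η n ≤ 0 :=
      mul_nonpos_of_nonneg_of_nonpos (by positivity) (not_lt.1 h)
    linarith
  -- Here `2 t = 1/12`, and with `θ = 41 * 2⁻¹ ^ 24` the noise term `4 θ / t ^ 2` is below `1/12`.
  refine (lintegral_measure_runAccepts_le hA η hnN (t := 1 / 24) (by norm_num) hW
    (sum_abs_mul_secondMoment_le l hη.le hS hμ hμ0.le hμS' (by positivity) (by norm_num)
      (hη2.trans hcle) hn3 hgrow)).trans ?_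
  rw [← ENNReal.ofReal_add (by norm_num) (by positivity)]
  apply ENNReal.ofReal_le_ofReal
  norm_num

end Parameters

/-! ### Estimating the scale by one bilinear query -/

section Scale

variable {d : ℕ} {A : Matrix (Fin d) (Fin d) ℝ} {l : Fin d → ℝ} {u : Fin d → Fin d → ℝ}

lemma measurable_bilin (A : Matrix (Fin d) (Fin d) ℝ) :
    Measurable fun p : (Fin d → ℝ) × (Fin d → ℝ) => p.1 ⬝ᵥ A.mulVec p.2 := by
  unfold Matrix.mulVec dotProduct; fun_prop

/-- The value of a Gaussian bilinear query is unlikely to be small. -/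
lemma prob_bilin_small_le (hA : IsEigenSystem A l u) (hsymm : ∀ x y, x ⬝ᵥ A.mulVec y =
    A.mulVec x ⬝ᵥ y) {μ t : ℝ} (hμ0 : 0 < μ) (ht : 0 < t) (hμl : ∃ i, l i = -μ) :
    ((gaussianVector d).prod (gaussianVector d))
      {p | |p.1 ⬝ᵥ A.mulVec p.2| ≤ t ^ 2 * μ} ≤ ENNReal.ofReal (2 * t) := by
  obtain ⟨i, hi⟩ := hμl
  have hm : MeasurableSet {p : (Fin d → ℝ) × (Fin d → ℝ) | |p.1 ⬝ᵥ A.mulVec p.2| ≤ t ^ 2 * μ} :=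
    measurableSet_le (by simpa using (measurable_bilin A).norm) measurable_const
  have hm2 : MeasurableSet {v : Fin d → ℝ | |u i ⬝ᵥ v| ≤ t * 1} := by
    refine measurableSet_le ?_ measurable_const
    unfold dotProduct; fun_prop
  rw [Measure.prod_apply hm]
  -- Anti-concentration is used twice: outside an event of probability at most `t` in `v` the vector
  -- `A v` has norm at least `t μ`, and then its product with `w` is at most `t * (t μ)` in absolute
  -- value with probability at most `t`.
  have hpt : ∀ v, gaussianVector d (Prod.mk v ⁻¹' {p | |p.1 ⬝ᵥ A.mulVec p.2| ≤ t ^ 2 * μ}) ≤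
      {v : Fin d → ℝ | |u i ⬝ᵥ v| ≤ t * 1}.indicator 1 v + ENNReal.ofReal t := by
    intro v
    by_cases hv : v ∈ {v : Fin d → ℝ | |u i ⬝ᵥ v| ≤ t * 1}
    · rw [Set.indicator_of_mem hv]
      exact prob_le_one.trans le_self_add
    · rw [Set.indicator_of_notMem hv, zero_add]
      rw [Set.mem_ofPred_eq, not_le, mul_one] at hv
      have h1 : (t * μ) ^ 2 ≤ A.mulVec v ⬝ᵥ A.mulVec v := by
        rw [hA.sq_eq]
        have h2 := Finset.single_le_sum (f := fun j => l j ^ 2 * (u j ⬝ᵥ v) ^ 2)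
          (fun j _ => by positivity) (Finset.mem_univ i)
        refine le_trans ?_ h2
        have h3 : t ^ 2 ≤ (u i ⬝ᵥ v) ^ 2 := by
          rw [← sq_abs (u i ⬝ᵥ v)]
          exact pow_le_pow_left₀ ht.le hv.le 2
        have h4 := mul_le_mul_of_nonneg_left h3 (sq_nonneg μ)
        simp only [hi, neg_sq]
        linarith
      have h5 := gaussianVector_abs_dotProduct_le (v := A.mulVec v) (a := t * μ) (t := t)
        (by positivity) h1
      refine le_trans (measure_mono fun w hw => ?_) h5
      simp only [Set.mem_preimage, Set.mem_ofPred_eq] at hw ⊢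
      rw [← hsymm]
      linarith
  refine (lintegral_mono hpt).trans ?_
  rw [lintegral_add_right _ measurable_const, lintegral_indicator_one hm2, lintegral_const,
    measure_univ]
  have := gaussianVector_abs_dotProduct_le (v := u i) (a := 1) (t := t) one_pos
      (by rw [hA.dotProduct_self]; norm_num)
  calc _ ≤ ENNReal.ofReal t + ENNReal.ofReal t := add_le_add this (mul_one _).le
    _ = _ := by rw [← ENNReal.ofReal_add ht.le ht.le]; congr 1; ring

/-- The value of a Gaussian bilinear query is unlikely to be large. -/
lemma prob_bilin_large_le (hA : IsEigenSystem A l u) (hsymm : ∀ x y, x ⬝ᵥ A.mulVec y =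
    A.mulVec x ⬝ᵥ y) {S : ℝ} (hS0 : 0 < S) (hS : ∑ i, |l i| ≤ S) :
    ((gaussianVector d).prod (gaussianVector d))
      {p | 4 * S < |p.1 ⬝ᵥ A.mulVec p.2|} ≤ ENNReal.ofReal (1 / 16) := by
  set f : (Fin d → ℝ) × (Fin d → ℝ) → ℝ≥0∞ := fun p =>
    ENNReal.ofReal ((p.1 ⬝ᵥ A.mulVec p.2) ^ 2) with hf
  have hfm : Measurable f := ENNReal.measurable_ofReal.comp ((measurable_bilin A).pow_const 2)
  -- The second moment of the query is the squared Frobenius norm `∑ l i ^ 2`, at most `(∑ |l i|) ^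
  -- 2`.
  have hint : ∫⁻ p, f p ∂(gaussianVector d).prod (gaussianVector d) ≤ ENNReal.ofReal (S ^ 2) := by
    rw [lintegral_prod _ hfm.aemeasurable]
    have h1 : ∀ v, ∫⁻ w, f (v, w) ∂gaussianVector d =
        ENNReal.ofReal (∑ i, l i ^ 2 * (u i ⬝ᵥ v) ^ 2) := by
      intro v
      simp only [hf, hsymm]
      rw [← ofReal_integral_eq_lintegral_ofReal (integrable_pow_dotProduct_gaussianVector _ 2)
        (Filter.Eventually.of_forall fun w => sq_nonneg _), integral_sq_dotProduct_gaussianVector,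
        hA.sq_eq]
    rw [lintegral_congr h1, ← ofReal_integral_eq_lintegral_ofReal
      (integrable_finsetSum _ fun i _ =>
        (integrable_pow_dotProduct_gaussianVector (u i) 2).const_mul _)
      (Filter.Eventually.of_forall fun v => Finset.sum_nonneg fun i _ => by positivity),
      integral_finsetSum _ fun i _ =>
        (integrable_pow_dotProduct_gaussianVector (u i) 2).const_mul _]
    simp only [integral_const_mul, integral_sq_dotProduct_gaussianVector, hA.dotProduct_self,
      mul_one]
    apply ENNReal.ofReal_le_ofReal
    calc ∑ i, l i ^ 2 = ∑ i, |l i| ^ 2 := by simp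
      _ ≤ (∑ i, |l i|) ^ 2 := Finset.sum_sq_le_sq_sum_of_nonneg fun i _ => abs_nonneg _
      _ ≤ S ^ 2 := pow_le_pow_left₀ (Finset.sum_nonneg fun i _ => abs_nonneg _) hS 2
  have hmark := meas_ge_le_lintegral_div (μ := (gaussianVector d).prod (gaussianVector d))
    hfm.aemeasurable (ε := ENNReal.ofReal (16 * S ^ 2))
    (by rw [Ne, ENNReal.ofReal_eq_zero, not_le]; positivity) ENNReal.ofReal_ne_top
  refine le_trans (measure_mono fun p hp => ?_) (hmark.trans ((ENNReal.div_le_div_right hint _).trans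
    (le_of_eq ?_)))
  · rw [Set.mem_ofPred_eq] at hp ⊢
    apply ENNReal.ofReal_le_ofReal
    rw [← sq_abs (p.1 ⬝ᵥ _)]
    have := pow_le_pow_left₀ (by positivity) hp.le 2
    linarith
  · rw [← ENNReal.ofReal_div_of_pos (by positivity)]
    congr 1
    field_simp

end Scale

/-! ### Schatten norms and eigenvalues -/

section Schatten

variable {d : ℕ}

lemma schattenNorm_one (A : Matrix (Fin d) (Fin d) ℝ) :
    schattenNorm 1 A = ∑ i : Fin d, A.toEuclideanLin.singularValues i := by
  rw [schattenNorm, PiLp.norm_eq_of_L1]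
  exact Finset.sum_congr rfl fun i _ => Real.norm_of_nonneg (LinearMap.singularValues_nonneg _ _)

lemma rpow_mul_schattenNorm_one_le (hd : 1 ≤ d) {p : ℝ≥0∞} (hp : 1 ≤ p)
    (A : Matrix (Fin d) (Fin d) ℝ) :
    (d : ℝ) ^ ((1 / p).toReal - 1) * schattenNorm 1 A ≤ schattenNorm p A := by
  have hd0 : (0 : ℝ) < d := by exact_mod_cast hd
  have hσ : ∀ i : Fin d, 0 ≤ A.toEuclideanLin.singularValues i :=
    fun i => LinearMap.singularValues_nonneg _ _
  rw [schattenNorm_one]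
  rcases eq_or_ne p ∞ with rfl | hpt
  · have hne : Nonempty (Fin d) := ⟨⟨0, hd⟩⟩
    rw [schattenNorm, PiLp.norm_eq_ciSup]
    have h1 : ∀ i : Fin d, A.toEuclideanLin.singularValues i ≤
        ⨆ i : Fin d, ‖A.toEuclideanLin.singularValues i‖ := fun i =>
      (Real.le_norm_self _).trans
        (le_ciSup (f := fun i : Fin d => ‖A.toEuclideanLin.singularValues i‖)
          (Set.finite_range _).bddAbove i)
    have h2 := Finset.sum_le_sum fun i (_ : i ∈ Finset.univ) => h1 i
    rw [Finset.sum_const, Finset.card_univ, Fintype.card_fin, nsmul_eq_mul] at h2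
    simp only [ENNReal.div_top, ENNReal.toReal_zero, zero_sub, Real.rpow_neg_one]
    rw [inv_mul_le_iff₀ hd0]
    exact h2
  · have hp1 : 1 ≤ p.toReal := by
      rw [← ENNReal.toReal_one]; exact ENNReal.toReal_mono hpt hp
    have hp0 : 0 < p.toReal := by linarith
    rw [schattenNorm, PiLp.norm_eq_sum hp0]
    have h1 := Real.rpow_sum_le_const_mul_sum_rpow_of_nonneg
      (f := fun i : Fin d => A.toEuclideanLin.singularValues i) Finset.univ hp1 fun i _ => hσ i
    rw [Finset.card_univ, Fintype.card_fin] at h1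
    have h2 := Real.rpow_le_rpow (Real.rpow_nonneg (Finset.sum_nonneg fun i _ => hσ i) _) h1
      (by positivity : 0 ≤ 1 / p.toReal)
    rw [← Real.rpow_mul (Finset.sum_nonneg fun i _ => hσ i), mul_one_div_cancel hp0.ne',
      Real.rpow_one, Real.mul_rpow (by positivity)
        (Finset.sum_nonneg fun i _ => Real.rpow_nonneg (hσ i) _), ← Real.rpow_mul hd0.le] at h2
    have h3 : (p.toReal - 1) * (1 / p.toReal) = -((1 / p).toReal - 1) := by
      rw [ENNReal.toReal_div, ENNReal.toReal_one]
      field_simp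
      ring
    rw [h3, Real.rpow_neg hd0.le, ← div_eq_inv_mul, le_div_iff₀ (Real.rpow_pos_of_pos hd0 _)] at h2
    have h4 : ∀ i : Fin d, ‖A.toEuclideanLin.singularValues i‖ =
        A.toEuclideanLin.singularValues i := fun i => Real.norm_of_nonneg (hσ i)
    simp only [h4]
    linarith

lemma norm_toEuclideanLin_eigenvectorBasis (A : Matrix (Fin d) (Fin d) ℝ) (i : Fin d) :
    ‖A.toEuclideanLin (A.toEuclideanLin.isSymmetric_adjoint_comp_self.eigenvectorBasis
      finrank_euclideanSpace_fin i)‖ = A.toEuclideanLin.singularValues i := by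
  set T := A.toEuclideanLin
  set f := T.isSymmetric_adjoint_comp_self.eigenvectorBasis finrank_euclideanSpace_fin
  rw [← abs_of_nonneg (norm_nonneg (T (f i))), ← abs_of_nonneg (T.singularValues_nonneg i),
    ← sq_eq_sq_iff_abs_eq_abs, T.sq_singularValues_fin finrank_euclideanSpace_fin,
    ← real_inner_self_eq_norm_sq, ← LinearMap.adjoint_inner_left]
  have h := T.isSymmetric_adjoint_comp_self.apply_eigenvectorBasis finrank_euclideanSpace_fin i
  rw [LinearMap.comp_apply] at h
  rw [h, real_inner_smul_left, real_inner_self_eq_norm_sq, f.norm_eq_one]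
  simp

/-- Expand each `⟨T u_j, u_j⟩` in a basis `f` of right singular vectors. For fixed `i`,
Cauchy–Schwarz over `j` bounds the sum by `‖T f_i‖ ‖f_i‖`, which is the `i`-th singular value.
Equality holds, but this direction suffices. -/
lemma sum_abs_eigenvalues_le_schattenNorm_one {A : Matrix (Fin d) (Fin d) ℝ}
    (hA : A.IsHermitian) : ∑ i, |hA.eigenvalues i| ≤ schattenNorm 1 A := by
  set T := A.toEuclideanLin with hT
  set f := T.isSymmetric_adjoint_comp_self.eigenvectorBasis finrank_euclideanSpace_fin with hf
  set u := hA.eigenvectorBasis with hu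
  have hTu : ∀ j, T (u j) = hA.eigenvalues j • u j := by
    intro j
    apply (WithLp.linearEquiv 2 ℝ (Fin d → ℝ)).injective
    exact hA.mulVec_eigenvectorBasis j
  have hsym : T.IsSymmetric := Matrix.isSymmetric_toEuclideanLin_iff.2 hA
  have h1 : ∀ j, |hA.eigenvalues j| ≤ ∑ i, |inner ℝ (u j) (T (f i))| * |inner ℝ (u j) (f i)| := by
    intro j
    have h2 : hA.eigenvalues j = inner ℝ (T (u j)) (u j) := by
      rw [hTu, real_inner_smul_left, real_inner_self_eq_norm_sq, u.norm_eq_one]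
      simp
    rw [h2, ← f.sum_inner_mul_inner]
    refine (Finset.abs_sum_le_sum_abs _ _).trans (Finset.sum_le_sum fun i _ => ?_)
    rw [abs_mul, hsym, real_inner_comm (u j) (f i)]
  rw [schattenNorm_one]
  refine (Finset.sum_le_sum fun j _ => h1 j).trans ?_
  rw [Finset.sum_comm]
  refine Finset.sum_le_sum fun i _ => ?_
  refine (Real.sum_mul_le_sqrt_mul_sqrt _ _ _).trans (le_of_eq ?_)
  simp only [sq_abs, u.sum_sq_inner_right, f.norm_eq_one]
  rw [Real.sqrt_sq (norm_nonneg _), norm_toEuclideanLin_eigenvectorBasis]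
  simp

lemma isEigenSystem_of_isHermitian {A : Matrix (Fin d) (Fin d) ℝ} (hA : A.IsHermitian) :
    IsEigenSystem A hA.eigenvalues fun i => (hA.eigenvectorBasis i).ofLp := by
  set u := hA.eigenvectorBasis with hu
  have hinner : ∀ x y : Fin d → ℝ,
      inner ℝ (WithLp.toLp 2 x : EuclideanSpace ℝ (Fin d)) (WithLp.toLp 2 y) = x ⬝ᵥ y := by
    intro x y
    rw [EuclideanSpace.inner_toLp_toLp, star_trivial, dotProduct_comm]
  have hpars : ∀ x y : Fin d → ℝ, x ⬝ᵥ y = ∑ i, ((u i).ofLp ⬝ᵥ x) * ((u i).ofLp ⬝ᵥ y) := by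
    intro x y
    rw [← hinner, ← u.sum_inner_mul_inner]
    refine Finset.sum_congr rfl fun i _ => ?_
    rw [← hinner, ← hinner, WithLp.toLp_ofLp, real_inner_comm]
  have hmul : ∀ i x, (u i).ofLp ⬝ᵥ A.mulVec x = hA.eigenvalues i * ((u i).ofLp ⬝ᵥ x) := by
    intro i x
    have hAt : A.transpose = A := by simpa using hA.eq
    have := hA.mulVec_eigenvectorBasis i
    rw [Matrix.dotProduct_mulVec, ← Matrix.mulVec_transpose, hAt, this, smul_dotProduct]
    rfl
  refine ⟨fun i => ?_, hmul, fun x => ?_, fun x => ?_⟩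
  · rw [← hinner, WithLp.toLp_ofLp, real_inner_self_eq_norm_sq, u.norm_eq_one]
    norm_num
  · rw [hpars]
    exact Finset.sum_congr rfl fun i _ => by rw [hmul]; ring
  · rw [hpars]
    exact Finset.sum_congr rfl fun i _ => by rw [hmul]; ring

lemma schattenNorm_one_pos {A : Matrix (Fin d) (Fin d) ℝ} (hA : A.IsHermitian) (h0 : A ≠ 0) :
    0 < schattenNorm 1 A := by
  refine lt_of_lt_of_le ?_ (sum_abs_eigenvalues_le_schattenNorm_one hA)
  have h1 : hA.eigenvalues ≠ 0 := fun h => h0 (hA.eigenvalues_eq_zero_iff.1 h)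
  obtain ⟨i, hi⟩ := Function.ne_iff.1 h1
  exact Finset.sum_pos' (fun j _ => abs_nonneg _) ⟨i, Finset.mem_univ i, abs_pos.2 hi⟩

lemma isFarFromPSD_one_of_isFarFromPSD (hd : 1 ≤ d) {p : ℝ≥0∞} (hp : 1 ≤ p) {ε : ℝ} (hε : 0 < ε)
    {A : Matrix (Fin d) (Fin d) ℝ} (hA : IsFarFromPSD ε p A) :
    IsFarFromPSD (ε * (d : ℝ) ^ ((1 / p).toReal - 1)) 1 A := by
  obtain ⟨h0, hH, h1⟩ := hA
  refine ⟨h0, hH, h1.trans ?_⟩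
  have := mul_le_mul_of_nonneg_left (rpow_mul_schattenNorm_one_le hd hp A) hε.le
  linarith

end Schatten

/-! ### The tester and its analysis -/

section Tester

/-- The number of runs: the ratio of the preliminary estimate and the Schatten `1`-norm is known up
to a factor of order `1 / ε`, and the runs try step sizes on a dyadic scale. -/
noncomputable def numRuns (ε : ℝ) : ℕ := ⌊Real.log (2304 / ε) / Real.log 2⌋₊ + 2

/-- The step sizes of the runs as functions of the value of a single preliminary query. -/
noncomputable def stepSizes (ε : ℝ) (s : Fin 1 → ℝ) (r : Fin (numRuns ε)) : ℝ :=
  -- The value `1` only keeps the step size positive; a vanishing query belongs to the failure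
  -- event.
  if s 0 = 0 then 1 else 4 * stepScale ε / (|s 0| * 2 ^ (r : ℕ))

/-- The Oja-type tester for the Schatten `1`-norm. -/
noncomputable def schattenOneTester (d : ℕ) (ε : ℝ) : VMVTester d :=
  ojaTester d 1 (numRuns ε) (runLength ε) (stepSizes ε)

lemma stepSizes_pos {ε : ℝ} (h0 : 0 < ε) (h1 : ε < 1) (s : Fin 1 → ℝ) (r : Fin (numRuns ε)) :
    0 < stepSizes ε s r := by
  have := stepScale_pos h0 h1
  unfold stepSizes
  split_ifs with h
  · exact one_pos
  · positivity

lemma measurable_stepSizes (ε : ℝ) : Measurable (stepSizes ε) := by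
  refine measurable_pi_lambda _ fun r => ?_
  unfold stepSizes
  refine Measurable.ite ?_ measurable_const ?_
  · exact measurableSet_eq_fun (measurable_pi_apply (0 : Fin 1)) measurable_const
  · have : Measurable fun s : Fin 1 → ℝ => |s 0| := by
      simpa using (measurable_pi_apply (X := fun _ : Fin 1 => ℝ) (0 : Fin 1)).norm
    exact measurable_const.div (this.mul_const _)

/-- If the preliminary value is of the right order, then some run has a step size of the right
order. -/
lemma exists_stepSizes_mul_mem {ε S : ℝ} (h0 : 0 < ε) (h1 : ε < 1) {s : Fin 1 → ℝ}
    (hs1 : ε * S < 576 * |s 0|) (hs2 : |s 0| ≤ 4 * S) (hS : 0 < S) :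
    ∃ r, stepScale ε / 2 ≤ stepSizes ε s r * S ∧ stepSizes ε s r * S ≤ stepScale ε := by
  have hc := stepScale_pos h0 h1
  have hpos : 0 < |s 0| := by
    have : 0 < ε * S := by positivity
    linarith
  have hne : s 0 ≠ 0 := abs_pos.1 hpos
  set y := 4 * S / |s 0| with hy
  have hy1 : 1 ≤ y := by rwa [hy, le_div_iff₀ hpos, one_mul]
  have hy2 : y < 2304 / ε := by
    rw [hy, div_lt_div_iff₀ hpos h0]; linarith
  obtain ⟨m, hm1, hm2⟩ := exists_nat_pow_near hy1 (one_lt_two : (1 : ℝ) < 2)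
  have hm : m ≤ ⌊Real.log (2304 / ε) / Real.log 2⌋₊ := by
    have hl2 : 0 < Real.log 2 := Real.log_pos one_lt_two
    apply Nat.le_floor
    rw [le_div_iff₀ hl2, ← Real.log_pow]
    exact Real.log_le_log (by positivity) (by linarith)
  -- Since `2 ^ m ≤ y < 2 ^ (m + 1)`, the exponent `m + 1` puts `y / 2 ^ (m + 1)` in `[1/2, 1)`. The
  -- `+ 2` in `numRuns` makes room for this index.
  refine ⟨⟨m + 1, by unfold numRuns; omega⟩, ?_⟩
  have h2 : stepSizes ε s ⟨m + 1, by unfold numRuns; omega⟩ * S =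
      stepScale ε * (y / 2 ^ (m + 1)) := by
    rw [stepSizes, if_neg hne, hy]
    field_simp
  rw [h2]
  have hp : (0 : ℝ) < 2 ^ (m + 1) := by positivity
  have h3 : 1 / 2 ≤ y / 2 ^ (m + 1) := by
    rw [le_div_iff₀ hp, pow_succ]; linarith
  have h4 : y / 2 ^ (m + 1) ≤ 1 := by
    rw [div_le_one hp]; exact hm2.le
  constructor <;> nlinarith

lemma numQueries_bound {ε : ℝ} (h0 : 0 < ε) (h1 : ε < 1) :
    ((numRuns ε * (2 * runLength ε + 1) + 1 : ℕ) : ℝ) ≤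
      2 ^ 43 * (1 / ε * Real.log (2 / ε) ^ 3) := by
  have hL := half_le_log_two_div h0 h1
  have hL2 := log_two_le_log_two_div h0 h1
  set L := Real.log (2 / ε) with hLdef
  have hR : (numRuns ε : ℝ) ≤ 28 * L := by
    have h2 : Real.log (2304 / ε) ≤ 12 * L := by
      have h3 : (2304 : ℝ) / ε = 1152 * (2 / ε) := by ring
      have h4 : Real.log 1152 ≤ 11 * Real.log 2 := by
        have := Real.log_pow (n := 11) (x := 2)
        push_cast at this
        rw [← this]
        exact Real.log_le_log (by norm_num) (by norm_num)
      rw [h3, Real.log_mul (by norm_num) (by positivity)]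
      linarith
    have h5 : 1 / 2 < Real.log 2 := by linarith [Real.log_two_gt_d9]
    have h6 : 0 ≤ Real.log (2304 / ε) :=
      Real.log_nonneg (by rw [le_div_iff₀ h0]; linarith)
    have h7 : (⌊Real.log (2304 / ε) / Real.log 2⌋₊ : ℝ) ≤ 24 * L := by
      refine (Nat.floor_le (by positivity)).trans ?_
      rw [div_le_iff₀ (by positivity)]
      nlinarith
    unfold numRuns
    push_cast
    linarith
  have hN : (runLength ε : ℝ) ≤ 1352 * 2 ^ 24 * (1 / ε * L ^ 2) := by
    have hc := stepScale_pos h0 h1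
    refine (Nat.floor_le (by positivity)).trans (le_of_eq ?_)
    unfold stepScale
    rw [← hLdef]
    field_simp
    norm_num
  have he : 1 ≤ 1 / ε := by rw [le_div_iff₀ h0]; linarith
  have h8 : 1 ≤ 4 * (1 / ε * L ^ 2) := by nlinarith
  have h9 : 1 ≤ 8 * (1 / ε * L ^ 3) := by nlinarith [mul_le_mul h8 hL (by norm_num) (by positivity)]
  push_cast
  calc (numRuns ε : ℝ) * (2 * runLength ε + 1) + 1
      ≤ 28 * L * (2 * (1352 * 2 ^ 24 * (1 / ε * L ^ 2)) + 4 * (1 / ε * L ^ 2)) +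
        8 * (1 / ε * L ^ 3) := by gcongr
    _ = (28 * (2 * 1352 * 2 ^ 24 + 4) + 8) * (1 / ε * L ^ 3) := by ring
    _ ≤ _ := by
      refine mul_le_mul_of_nonneg_right (by norm_num) (by positivity)

variable {d : ℕ}

lemma schattenOneTester_output (ε : ℝ) (A : Matrix (Fin d) (Fin d) ℝ)
    (ω : (schattenOneTester d ε).Ω) :
    ((schattenOneTester d ε).alg ω).output A = true ↔
      ∀ r, RunAccepts A (stepSizes ε (fun i => ω.1 i ⬝ᵥ A.mulVec (ω.2.1 i)) r) (runLength ε)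
        (ω.2.2.2 r) (ω.2.2.1 r) := by
  change (probe 1 ω.1 ω.2.1 fun s => ojaRuns (numRuns ε) (stepSizes ε s) ω.2.2.1 ω.2.2.2).output A =
    true ↔ _
  rw [output_probe, output_ojaRuns]

lemma makesAtMost_schattenOneTester {ε : ℝ} (h0 : 0 < ε) (h1 : ε < 1) :
    (schattenOneTester d ε).MakesAtMost (2 ^ 43 * (1 / ε * Real.log (2 / ε) ^ 3)) := by
  intro A _ ω
  refine le_trans ?_ (numQueries_bound h0 h1)
  rw [Nat.cast_le]
  change (probe 1 ω.1 ω.2.1 fun s =>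
    ojaRuns (numRuns ε) (stepSizes ε s) ω.2.2.1 ω.2.2.2).numQueries A ≤ _
  rw [numQueries_probe]
  exact Nat.add_le_add_right (numQueries_ojaRuns_le _ _ _ _) 1

lemma isOneSided_schattenOneTester (ε : ℝ) : (schattenOneTester d ε).IsOneSided := by
  intro A hA ω
  rw [schattenOneTester_output]
  exact fun r => runAccepts_of_nonneg (fun x => by simpa using hA.dotProduct_mulVec_nonneg x) _ _ _ _

lemma measurableSet_outcome_schattenOneTester (ε : ℝ) (A : Matrix (Fin d) (Fin d) ℝ) (b : Bool) :
    MeasurableSet ((schattenOneTester d ε).outcome A b) := by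
  have htrue : MeasurableSet ((schattenOneTester d ε).outcome A true) := by
    simp only [VMVTester.outcome, schattenOneTester_output, Set.ofPred_forall]
    refine MeasurableSet.iInter fun r => ?_
    have hs : Measurable fun ω : (Fin 1 → Fin d → ℝ) × (Fin 1 → Fin d → ℝ) ×
        (Fin (numRuns ε) → Fin d → ℝ) × (Fin (numRuns ε) → Fin (runLength ε) → Fin d → ℝ) =>
        fun i => ω.1 i ⬝ᵥ A.mulVec (ω.2.1 i) :=
      measurable_pi_lambda _ fun i => (measurable_bilin A).comp
        (f := fun ω : (Fin 1 → Fin d → ℝ) × (Fin 1 → Fin d → ℝ) ×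
        (Fin (numRuns ε) → Fin d → ℝ) × (Fin (numRuns ε) → Fin (runLength ε) → Fin d → ℝ) =>
        (ω.1 i, ω.2.1 i)) (by fun_prop)
    have hm : Measurable fun ω : (Fin 1 → Fin d → ℝ) × (Fin 1 → Fin d → ℝ) ×
        (Fin (numRuns ε) → Fin d → ℝ) × (Fin (numRuns ε) → Fin (runLength ε) → Fin d → ℝ) =>
        (stepSizes ε (fun i => ω.1 i ⬝ᵥ A.mulVec (ω.2.1 i)) r, ω.2.2.2 r, ω.2.2.1 r) :=
      Measurable.prodMk ((measurable_pi_apply r).comp ((measurable_stepSizes ε).comp hs))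
        (by fun_prop)
    exact hm (measurableSet_runAccepts A (runLength ε))
  cases b with
  | true => exact htrue
  | false =>
    have : (schattenOneTester d ε).outcome A false = ((schattenOneTester d ε).outcome A true)ᶜ := by
      ext ω
      simp [VMVTester.outcome]
    rw [this]
    exact htrue.compl

/-- If one of the step sizes is of the right order, then all runs accept with probability at most
`1/6`. -/
lemma measure_forall_runAccepts_le {A : Matrix (Fin d) (Fin d) ℝ} {η δ : ℝ} {N R : ℕ}
    (ηs : Fin R → ℝ) (r : Fin R) (hr : ηs r = η)
    (h : ∫⁻ x, (Measure.pi fun _ : Fin N => gaussianVector d) {g | RunAccepts A η N g x}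
      ∂gaussianVector d ≤ ENNReal.ofReal δ) :
    ((Measure.pi fun _ : Fin R => gaussianVector d).prod
      (Measure.pi fun _ : Fin R => Measure.pi fun _ : Fin N => gaussianVector d))
      {p | ∀ r, RunAccepts A (ηs r) N (p.2 r) (p.1 r)} ≤ ENNReal.ofReal δ := by
  have hmp := (measurePreserving_eval (fun _ : Fin R => gaussianVector d) r).prod
    (measurePreserving_eval
      (fun _ : Fin R => Measure.pi fun _ : Fin N => gaussianVector d) r)
  have hms : MeasurableSet {p : (Fin d → ℝ) × (Fin N → Fin d → ℝ) | RunAccepts A η N p.2 p.1} := by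
    have hm : Measurable fun p : (Fin d → ℝ) × (Fin N → Fin d → ℝ) => (η, p.2, p.1) := by fun_prop
    exact hm (measurableSet_runAccepts A N)
  refine le_trans (le_trans (measure_mono fun p hp => ?_)
    (hmp.measure_preimage hms.nullMeasurableSet).le) ?_
  · have := hp r
    rw [hr] at this
    exact this
  · rw [Measure.prod_apply hms]
    exact h

lemma measure_outcome_true_le {ε : ℝ} (h0 : 0 < ε) (h1 : ε < 1) {A : Matrix (Fin d) (Fin d) ℝ}
    (hd : 1 ≤ d) (hA : IsFarFromPSD ε 1 A) :
    (schattenOneTester d ε).μ ((schattenOneTester d ε).outcome A true) ≤ ENNReal.ofReal (1 / 3) := by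
  obtain ⟨hA0, hH, hmin⟩ := hA
  have hne : Nonempty (Fin d) := ⟨⟨0, hd⟩⟩
  have hE := isEigenSystem_of_isHermitian hH
  set l := hH.eigenvalues with hl
  set S := schattenNorm 1 A with hSdef
  have hS0 : 0 < S := schattenNorm_one_pos hH hA0
  have hS : ∑ i, |l i| ≤ S := sum_abs_eigenvalues_le_schattenNorm_one hH
  set μ := -minEigenvalue hH with hμdef
  have hμS : ε * S ≤ μ := by linarith
  have hμ0 : 0 < μ := lt_of_lt_of_le (by positivity) hμS
  have hμ : ∀ i, -l i ≤ μ := fun i => neg_le_neg (ciInf_le (Set.finite_range _).bddBelow i)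
  have hμl : ∃ i, l i = -μ := by
    obtain ⟨i, hi⟩ := exists_eq_ciInf_of_finite (f := l)
    exact ⟨i, by rw [hi, hμdef, neg_neg]; rfl⟩
  have hsymm : ∀ x y, x ⬝ᵥ A.mulVec y = A.mulVec x ⬝ᵥ y := by
    intro x y
    have hAt : A.transpose = A := by simpa using hH.eq
    rw [Matrix.dotProduct_mulVec, ← Matrix.mulVec_transpose, hAt]
  -- The event that the scale estimate fails. Its probability is at most `1/12 + 1/16 < 1/6`, and
  -- `(1/24) ^ 2 = 1/576` matches `exists_stepSizes_mul_mem`.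
  set B : Set ((Fin d → ℝ) × (Fin d → ℝ)) := {p | |p.1 ⬝ᵥ A.mulVec p.2| ≤ (1 / 24) ^ 2 * μ} ∪
    {p | 4 * S < |p.1 ⬝ᵥ A.mulVec p.2|} with hB
  have habs : Measurable fun p : (Fin d → ℝ) × (Fin d → ℝ) => |p.1 ⬝ᵥ A.mulVec p.2| := by
    simpa using (measurable_bilin A).norm
  have hBm : MeasurableSet B :=
    (measurableSet_le habs measurable_const).union (measurableSet_lt measurable_const habs)
  have hPB : ((gaussianVector d).prod (gaussianVector d)) B ≤ ENNReal.ofReal (1 / 6) := by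
    refine (measure_union_le _ _).trans ((add_le_add
      (prob_bilin_small_le hE hsymm hμ0 (by norm_num) hμl)
      (prob_bilin_large_le hE hsymm hS0 hS)).trans ?_)
    rw [← ENNReal.ofReal_add (by norm_num) (by norm_num)]
    apply ENNReal.ofReal_le_ofReal
    norm_num
  set ν := Measure.pi fun _ : Fin 1 => gaussianVector d with hν
  set ρ := (Measure.pi fun _ : Fin (numRuns ε) => gaussianVector d).prod
    (Measure.pi fun _ : Fin (numRuns ε) => Measure.pi fun _ : Fin (runLength ε) =>
      gaussianVector d) with hρ
  have hBm' : MeasurableSet {q : (Fin 1 → Fin d → ℝ) × (Fin 1 → Fin d → ℝ) | (q.1 0, q.2 0) ∈ B} :=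
    (by fun_prop : Measurable fun q : (Fin 1 → Fin d → ℝ) × (Fin 1 → Fin d → ℝ) =>
      (q.1 0, q.2 0)) hBm
  have hPB' : (ν.prod ν) {q | (q.1 0, q.2 0) ∈ B} ≤ ENNReal.ofReal (1 / 6) := by
    have hmp := (measurePreserving_eval (fun _ : Fin 1 => gaussianVector d) 0).prod
      (measurePreserving_eval (fun _ : Fin 1 => gaussianVector d) 0)
    exact (hmp.measure_preimage hBm.nullMeasurableSet).le.trans hPB
  -- Conditioning on the preliminary query fixes the step sizes, so the run with the right one can
  -- be treated as having a deterministic step size.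
  have hsec : ∀ v w : Fin 1 → Fin d → ℝ, ρ {p | (v, w, p) ∈ (schattenOneTester d ε).outcome A true}
      ≤ {q : (Fin 1 → Fin d → ℝ) × (Fin 1 → Fin d → ℝ) | (q.1 0, q.2 0) ∈ B}.indicator 1 (v, w) +
        ENNReal.ofReal (1 / 6) := by
    intro v w
    by_cases hvw : (v 0, w 0) ∈ B
    · rw [Set.indicator_of_mem (by exact hvw)]
      exact prob_le_one.trans le_self_add
    rw [Set.indicator_of_notMem (by exact hvw), zero_add]
    simp only [VMVTester.outcome, schattenOneTester_output]
    rw [hB, Set.mem_union, not_or, Set.mem_ofPred_eq, Set.mem_ofPred_eq, not_le, not_lt] at hvw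
    obtain ⟨r, hr1, hr2⟩ := exists_stepSizes_mul_mem (S := S) h0 h1
      (s := fun i => v i ⬝ᵥ A.mulVec (w i)) (by have := hvw.1; norm_num at this ⊢; linarith) hvw.2 hS0
    exact measure_forall_runAccepts_le _ r rfl
      (lintegral_measure_runAccepts_le_sixth hE h0 h1 hS0 hS hμS hμ hμl hr1 hr2)
  have hmeas := measurableSet_outcome_schattenOneTester ε A true
  have hprod : (schattenOneTester d ε).μ ((schattenOneTester d ε).outcome A true) =
      ∫⁻ v, ∫⁻ w, ρ {p | (v, w, p) ∈ (schattenOneTester d ε).outcome A true} ∂ν ∂ν := by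
    change (ν.prod (ν.prod ρ)) _ = _
    rw [Measure.prod_apply hmeas]
    refine lintegral_congr fun v => ?_
    rw [Measure.prod_apply (measurable_prodMk_left hmeas)]
    rfl
  rw [hprod]
  calc _ ≤ ∫⁻ v, ∫⁻ w, ({q : (Fin 1 → Fin d → ℝ) × (Fin 1 → Fin d → ℝ) |
        (q.1 0, q.2 0) ∈ B}.indicator 1 (v, w) + ENNReal.ofReal (1 / 6)) ∂ν ∂ν :=
        lintegral_mono fun v => lintegral_mono fun w => hsec v w
    _ = (ν.prod ν) {q | (q.1 0, q.2 0) ∈ B} + ENNReal.ofReal (1 / 6) := by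
        rw [← lintegral_prod (fun q : (Fin 1 → Fin d → ℝ) × (Fin 1 → Fin d → ℝ) =>
          {q : (Fin 1 → Fin d → ℝ) × (Fin 1 → Fin d → ℝ) |
            (q.1 0, q.2 0) ∈ B}.indicator 1 q + ENNReal.ofReal (1 / 6))
          ((measurable_one.indicator hBm').add_const _).aemeasurable,
          lintegral_add_right _ measurable_const, lintegral_indicator_one hBm', lintegral_const,
          measure_univ, mul_one]
    _ ≤ ENNReal.ofReal (1 / 6) + ENNReal.ofReal (1 / 6) := by gcongr
    _ = _ := by rw [← ENNReal.ofReal_add (by norm_num) (by norm_num)]; norm_num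

lemma isTester_schattenOneTester (hd : 1 ≤ d) {ε : ℝ} (h0 : 0 < ε) (h1 : ε < 1) :
    (schattenOneTester d ε).IsTester ε 1 where
  measurableSet_outcome A _ b := measurableSet_outcome_schattenOneTester ε A b
  accepts A hA := by
    have : (schattenOneTester d ε).outcome A true = Set.univ :=
      Set.eq_univ_of_forall fun ω => isOneSided_schattenOneTester ε A hA ω
    rw [this, probReal_univ]
    norm_num
  rejects A hA := by
    have hc : (schattenOneTester d ε).outcome A false =
        ((schattenOneTester d ε).outcome A true)ᶜ := by
      ext ω
      simp [VMVTester.outcome]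
    rw [hc, probReal_compl_eq_one_sub (measurableSet_outcome_schattenOneTester ε A true)]
    have := ENNReal.toReal_mono ENNReal.ofReal_ne_top (measure_outcome_true_le h0 h1 hd hA)
    rw [ENNReal.toReal_ofReal (by norm_num)] at this
    rw [Measure.real]
    linarith

lemma isOjaType_schattenOneTester {ε : ℝ} (h0 : 0 < ε) (h1 : ε < 1) :
    (schattenOneTester d ε).IsOjaType :=
  ⟨1, numRuns ε, runLength ε, stepSizes ε, measurable_stepSizes ε, stepSizes_pos h0 h1, rfl⟩

end Tester

end PSDTesting

theorem mainTheorem1 :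
    -- `‖A‖_p ≥ d^{1/p-1} ‖A‖_1`
    (∀ (d : ℕ) (p : ℝ≥0∞) (A : Matrix (Fin d) (Fin d) ℝ), 1 ≤ d → 1 ≤ p →
      (d : ℝ) ^ ((1 / p).toReal - 1) * PSDTesting.schattenNorm 1 A ≤
        PSDTesting.schattenNorm p A) ∧
    ∃ C : ℝ, 0 < C ∧
      -- the `(ε, ℓ_1)`-tester
      (∀ (d : ℕ) (ε : ℝ), 1 ≤ d → 0 < ε → ε < 1 →
        ∃ T : PSDTesting.VMVTester d, T.IsTester ε 1 ∧ T.IsOneSided ∧ T.IsOjaType ∧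
          T.MakesAtMost (C * ((1 / ε) * Real.log (2 / ε) ^ 3))) ∧
      -- the `(ε, ℓ_p)`-tester
      (∀ (d : ℕ) (p : ℝ≥0∞) (ε : ℝ), 1 ≤ d → 1 ≤ p → 0 < ε → ε < 1 →
        ∃ T : PSDTesting.VMVTester d, T.IsTester ε p ∧ T.IsOneSided ∧ T.IsOjaType ∧
          T.MakesAtMost (C * ((1 / ε) * (d : ℝ) ^ (1 - (1 / p).toReal) *
            Real.log (2 / ε * (d : ℝ) ^ (1 - (1 / p).toReal)) ^ 3))) := by
  refine ⟨fun d p A hd hp => PSDTesting.rpow_mul_schattenNorm_one_le hd hp A, 2 ^ 43, by norm_num,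
    fun d ε hd h0 h1 => ⟨PSDTesting.schattenOneTester d ε,
      PSDTesting.isTester_schattenOneTester hd h0 h1, PSDTesting.isOneSided_schattenOneTester ε,
      PSDTesting.isOjaType_schattenOneTester h0 h1,
      PSDTesting.makesAtMost_schattenOneTester h0 h1⟩, fun d p ε hd hp h0 h1 => ?_⟩
  have hd0 : (0 : ℝ) < d := by exact_mod_cast hd
  have hpos : (0 : ℝ) < (d : ℝ) ^ ((1 / p).toReal - 1) := Real.rpow_pos_of_pos hd0 _
  have hle : (d : ℝ) ^ ((1 / p).toReal - 1) ≤ 1 := by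
    refine Real.rpow_le_one_of_one_le_of_nonpos (by exact_mod_cast hd) ?_
    have : (1 / p).toReal ≤ 1 := by
      rw [← ENNReal.toReal_one]
      exact ENNReal.toReal_mono ENNReal.one_ne_top (by simpa using hp)
    linarith
  -- Being `ε`-far in `ℓ_p` implies being `ε'`-far in `ℓ_1`, and `1 / ε'` is exactly the quantity in
  -- the query bound.
  set ε' := ε * (d : ℝ) ^ ((1 / p).toReal - 1) with hε'
  have h0' : 0 < ε' := by positivity
  have h1' : ε' < 1 := by nlinarith
  have hT := PSDTesting.isTester_schattenOneTester hd h0' h1'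
  refine ⟨PSDTesting.schattenOneTester d ε', ⟨hT.measurableSet_outcome, hT.accepts,
    fun A hA => hT.rejects A (PSDTesting.isFarFromPSD_one_of_isFarFromPSD hd hp h0 hA)⟩,
    PSDTesting.isOneSided_schattenOneTester ε', PSDTesting.isOjaType_schattenOneTester h0' h1', ?_⟩
  have hinv : (d : ℝ) ^ (1 - (1 / p).toReal) = ((d : ℝ) ^ ((1 / p).toReal - 1))⁻¹ := by
    rw [← Real.rpow_neg hd0.le, neg_sub]
  have e1 : 1 / ε * (d : ℝ) ^ (1 - (1 / p).toReal) = 1 / ε' := by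
    rw [hinv, hε']; field_simp
  have e2 : 2 / ε * (d : ℝ) ^ (1 - (1 / p).toReal) = 2 / ε' := by
    rw [hinv, hε']; field_simp
  rw [e1, e2]
  exact PSDTesting.makesAtMost_schattenOneTester h0' h1'
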